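/- Let $W$ be a nonempty finite set and let $\mathscr G=(W,V)$ be a game with question set and answer set $W$ for both players, given by a rule function $V(a,b|x,y)\in\{0,1\}$ ($a,b,x,y\in W$; $x,y$ are questions and $a,b$ answers). Assume that $\mathscr G$ is - *bisynchronous*: $V(a,b|x,x)=0$ whenever $a\ne b$, and $V(a,a|x,y)=0$ whenever $x\neq y$; - *transitive*: if $V(a,b|r,s)=1$ and $V(r,s|x,y)=1$, then $V(a,b|x,y)=1$. Consider the relations $$u_{x,a}=u_{x,a}^*=u_{x,a}^2,\qquad \sum_{a\in W}u_{x,a}=1,\qquad u_{x,a}u_{y,b}=0\ \text{ if } V(a,b|x,y)=0 \tag{R}$$ in generators $u_{x,a}$ ($x,a\in W$), and let $C^*(\mathscr G)$ be the universal unital $C^*$-algebra they define: the completion of the free unital $*$-algebra on the generators, modulo elements of seminorm zero, in the seminorm $\|p\|=\sup_\pi\|\pi(p)\|$, where $\pi$ runs over the representations of (R) by bounded operators on Hilbert spaces. Assume that $\mathscr G$ has a *perfect $C^*$-strategy*, i.e. that (R) has a representation on a nonzero Hilbert space. All tensor products of $C^*$-algebras below are minimal. Then there is a unique unital $*$-homomorphism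 $\Delta\colon C^*(\mathscr G)\to C^*(\mathscr G)\otimes C^*(\mathscr G)$ with $$\Delta(u_{x,a})=\sum_{r\in W}u_{x,r}\otimes u_{r,a}\qquad (x,a\in W),$$ and $(C^*(\mathscr G),\Delta)$ is a compact quantum group: writing $A=C^*(\mathscr G)$, one has $A\neq0$ and $(\Delta\otimes\mathrm{id})\Delta=(\mathrm{id}\otimes\Delta)\Delta$, and the linear spans of $(1\otimes A)\Delta(A)$ and of $(A\otimes 1)\Delta(A)$ are dense in $A\otimes A$. Moreover, $(C^*(\mathscr G),\Delta)$ is a quantum permutation group acting on $W$: with $C(S_W^+)$ the universal unital $C^*$-algebra generated by elements $s_{i,j}$ ($i,j\in W$) with $s_{i,j}=s_{i,j}^*=s_{i,j}^2$ such that the matrix $[s_{i,j}]$ is unitary, there is a surjective unital $*$-homomorphism $\pi\colon C(S_W^+)\to C^*(\mathscr G)$ with $\Delta(\pi(s_{i,j}))=\sum_{k\in W}\pi(s_{i,k})\otimes\pi(s_{k,j})$ for all $i,j\in W$. -/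

import Mathlib

open scoped TensorProduct

universe u

/-! ### C⋆-seminorms and C⋆-completions -/

section CStarSeminorm

/-- A C⋆-seminorm on a complex `*`-algebra. -/
structure CStarSeminorm (𝒜 : Type*) [Ring 𝒜] [StarRing 𝒜] [Algebra ℂ 𝒜] where
  toFun : 𝒜 → ℝ
  map_zero' : toFun 0 = 0
  add_le' : ∀ a b, toFun (a + b) ≤ toFun a + toFun b
  smul' : ∀ (c : ℂ) a, toFun (c • a) = ‖c‖ * toFun a
  mul_le' : ∀ a b, toFun (a * b) ≤ toFun a * toFun b
  star_mul_self' : ∀ a, toFun (star a * a) = toFun a ^ 2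

namespace CStarSeminorm

variable {𝒜 : Type*} [Ring 𝒜] [StarRing 𝒜] [Algebra ℂ 𝒜]

instance : CoeFun (CStarSeminorm 𝒜) fun _ => 𝒜 → ℝ := ⟨toFun⟩

variable (p : CStarSeminorm 𝒜)

theorem neg_eq (a : 𝒜) : p (-a) = p a := by
  have := p.smul' (-1) a
  simpa using this

theorem nonneg (a : 𝒜) : 0 ≤ p a := by
  have h := p.add_le' a (-a)
  rw [add_neg_cancel, p.map_zero', p.neg_eq] at h
  linarith

theorem le_star (a : 𝒜) : p a ≤ p (star a) := by
  have h := p.mul_le' (star a) a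
  rw [p.star_mul_self'] at h
  rcases (p.nonneg a).eq_or_lt with h0 | h0
  · rw [← h0]; exact p.nonneg _
  · nlinarith

theorem star_eq (a : 𝒜) : p (star a) = p a :=
  le_antisymm (by simpa using p.le_star (star a)) (p.le_star a)

/-- The seminorm `a ↦ ‖π a‖` of a `*`-homomorphism `π` into a C⋆-algebra. -/
noncomputable def ofHom {B : Type*} [CStarAlgebra B] (π : 𝒜 →⋆ₐ[ℂ] B) : CStarSeminorm 𝒜 where
  toFun a := ‖π a‖
  map_zero' := by simp
  add_le' a b := by simpa using norm_add_le (π a) (π b)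
  smul' c a := by simp [norm_smul]
  mul_le' a b := by simpa using norm_mul_le (π a) (π b)
  star_mul_self' a := by simp [map_star, CStarRing.norm_star_mul_self, sq]

/-- The pointwise supremum of a pointwise bounded set of C⋆-seminorms
(the zero seminorm if the set is empty). -/
noncomputable def sup (S : Set (CStarSeminorm 𝒜)) (hS : ∀ a, ∃ C, ∀ p ∈ S, p a ≤ C) :
    CStarSeminorm 𝒜 :=
  have hb : ∀ a, BddAbove (Set.range fun p : S => p.1 a) := fun a => by
    obtain ⟨C, hC⟩ := hS a
    exact ⟨C, by rintro _ ⟨p, rfl⟩; exact hC p.1 p.2⟩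
  have h0 : ∀ a, 0 ≤ ⨆ p : S, p.1 a := fun a => Real.iSup_nonneg fun p => p.1.nonneg a
  have hle : ∀ (p : S) (a : 𝒜), p.1 a ≤ ⨆ p : S, p.1 a := fun p a => le_ciSup (hb a) p
  { toFun := fun a => ⨆ p : S, p.1 a
    map_zero' := by simp [CStarSeminorm.map_zero']
    add_le' := fun a b => Real.iSup_le
      (fun p => (p.1.add_le' a b).trans (add_le_add (hle p a) (hle p b)))
      (add_nonneg (h0 a) (h0 b))
    smul' := fun c a => by
      simp only [CStarSeminorm.smul']
      rw [Real.mul_iSup_of_nonneg (norm_nonneg c)]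
    mul_le' := fun a b => Real.iSup_le
      (fun p => (p.1.mul_le' a b).trans
        (mul_le_mul (hle p a) (hle p b) (p.1.nonneg b) (h0 a)))
      (mul_nonneg (h0 a) (h0 b))
    star_mul_self' := fun a => by
      refine le_antisymm (Real.iSup_le (fun p => ?_) (sq_nonneg _)) ?_
      · rw [p.1.star_mul_self']
        exact pow_le_pow_left₀ (p.1.nonneg a) (hle p a) 2
      · have : (⨆ p : S, p.1 a) ≤ √(⨆ p : S, p.1 (star a * a)) := by
          refine Real.iSup_le (fun p => Real.le_sqrt_of_sq_le ?_) (Real.sqrt_nonneg _)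
          rw [← p.1.star_mul_self']
          exact hle p _
        calc (⨆ p : S, p.1 a) ^ 2 ≤ √(⨆ p : S, p.1 (star a * a)) ^ 2 :=
              pow_le_pow_left₀ (h0 a) this 2
          _ = _ := Real.sq_sqrt (h0 _) }

theorem le_sup {S : Set (CStarSeminorm 𝒜)} (hS : ∀ a, ∃ C, ∀ p ∈ S, p a ≤ C)
    {p : CStarSeminorm 𝒜} (hp : p ∈ S) (a : 𝒜) : p a ≤ sup S hS a := by
  obtain ⟨C, hC⟩ := hS a
  exact le_ciSup (f := fun p : S => p.1 a) ⟨C, by rintro _ ⟨q, rfl⟩; exact hC q.1 q.2⟩ ⟨p, hp⟩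

theorem sup_le {S : Set (CStarSeminorm 𝒜)} (hS : ∀ a, ∃ C, ∀ p ∈ S, p a ≤ C)
    {a : 𝒜} {C : ℝ} (hC : 0 ≤ C) (h : ∀ p ∈ S, p a ≤ C) : sup S hS a ≤ C :=
  Real.iSup_le (fun p => h p.1 p.2) hC

/-- The `*`-algebra `𝒜`, to be topologized by the seminorm `p`. -/
def Carrier (_p : CStarSeminorm 𝒜) : Type _ := 𝒜

instance : Ring p.Carrier := inferInstanceAs (Ring 𝒜)
instance : StarRing p.Carrier := inferInstanceAs (StarRing 𝒜)
instance : Algebra ℂ p.Carrier := inferInstanceAs (Algebra ℂ 𝒜)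
instance [StarModule ℂ 𝒜] : StarModule ℂ p.Carrier := inferInstanceAs (StarModule ℂ 𝒜)

noncomputable instance : SeminormedRing p.Carrier where
  __ := (inferInstance : Ring p.Carrier)
  __ := AddGroupSeminorm.toSeminormedAddCommGroup
    (E := p.Carrier)
    { toFun := p.toFun
      map_zero' := p.map_zero'
      add_le' := p.add_le'
      neg' := p.neg_eq }
  norm_mul_le := p.mul_le'

theorem norm_carrier (a : p.Carrier) : ‖a‖ = p.toFun a := rfl

noncomputable instance : NormedAlgebra ℂ p.Carrier where
  norm_smul_le c a := (p.smul' c a).le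

instance : NormedStarGroup p.Carrier where
  norm_star_le a := (p.star_eq a).le

/-- The C⋆-algebra obtained from `𝒜` by dividing out the elements of seminorm zero
and completing. -/
def Completion (p : CStarSeminorm 𝒜) : Type _ := UniformSpace.Completion p.Carrier

/-- The extension of the involution to the completion. -/
noncomputable def starCompl :
    UniformSpace.Completion p.Carrier → UniformSpace.Completion p.Carrier :=
  UniformSpace.Completion.map (star : p.Carrier → p.Carrier)

theorem starCompl_coe (a : p.Carrier) : p.starCompl a = (star a : p.Carrier) :=
  UniformSpace.Completion.map_coe (star_isometry (E := p.Carrier)).uniformContinuous a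

theorem continuous_starCompl : Continuous p.starCompl := UniformSpace.Completion.continuous_map

theorem starCompl_starCompl (x : UniformSpace.Completion p.Carrier) :
    p.starCompl (p.starCompl x) = x :=
  UniformSpace.Completion.induction_on x
    (isClosed_eq (p.continuous_starCompl.comp p.continuous_starCompl) continuous_id)
    fun a => by rw [starCompl_coe, starCompl_coe, star_star]

theorem starCompl_mul (x y : UniformSpace.Completion p.Carrier) :
    p.starCompl (x * y) = p.starCompl y * p.starCompl x :=
  UniformSpace.Completion.induction_on₂ x y
    (isClosed_eq (p.continuous_starCompl.comp continuous_mul)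
      ((p.continuous_starCompl.comp continuous_snd).mul
        (p.continuous_starCompl.comp continuous_fst)))
    fun a b => by
      rw [← UniformSpace.Completion.coe_mul, starCompl_coe, starCompl_coe, starCompl_coe,
        ← UniformSpace.Completion.coe_mul, star_mul]

theorem starCompl_add (x y : UniformSpace.Completion p.Carrier) :
    p.starCompl (x + y) = p.starCompl x + p.starCompl y :=
  UniformSpace.Completion.induction_on₂ x y
    (isClosed_eq (p.continuous_starCompl.comp continuous_add)
      ((p.continuous_starCompl.comp continuous_fst).add
        (p.continuous_starCompl.comp continuous_snd)))
    fun a b => by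
      rw [← UniformSpace.Completion.coe_add, starCompl_coe, starCompl_coe, starCompl_coe,
        ← UniformSpace.Completion.coe_add, star_add]

theorem starCompl_smul [StarModule ℂ 𝒜] (c : ℂ) (x : UniformSpace.Completion p.Carrier) :
    p.starCompl (c • x) = star c • p.starCompl x :=
  UniformSpace.Completion.induction_on x
    (isClosed_eq (p.continuous_starCompl.comp (continuous_const_smul c))
      (p.continuous_starCompl.const_smul (star c)))
    fun a => by
      rw [← UniformSpace.Completion.coe_smul, starCompl_coe, starCompl_coe,
        ← UniformSpace.Completion.coe_smul, star_smul]

theorem norm_starCompl_mul_self (x : UniformSpace.Completion p.Carrier) :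
    ‖x‖ * ‖x‖ ≤ ‖p.starCompl x * x‖ :=
  UniformSpace.Completion.induction_on x
    (isClosed_le (continuous_norm.mul continuous_norm)
      (continuous_norm.comp (p.continuous_starCompl.mul continuous_id)))
    fun a => by
      rw [starCompl_coe, ← UniformSpace.Completion.coe_mul, UniformSpace.Completion.norm_coe,
        UniformSpace.Completion.norm_coe, norm_carrier, norm_carrier, ← sq]
      exact (p.star_mul_self' a).ge

noncomputable instance [StarModule ℂ 𝒜] : CStarAlgebra p.Completion where
  __ := (inferInstance : NormedRing (UniformSpace.Completion p.Carrier))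
  __ := (inferInstance : CompleteSpace (UniformSpace.Completion p.Carrier))
  __ := (inferInstance : Algebra ℂ (UniformSpace.Completion p.Carrier))
  norm_smul_le :=
    (inferInstance : NormedSpace ℂ (UniformSpace.Completion p.Carrier)).norm_smul_le
  star := p.starCompl
  star_involutive := p.starCompl_starCompl
  star_mul := p.starCompl_mul
  star_add := p.starCompl_add
  star_smul := p.starCompl_smul
  norm_mul_self_le := p.norm_starCompl_mul_self

variable [StarModule ℂ 𝒜]

/-- The canonical `*`-homomorphism of `𝒜` into its completion. -/
noncomputable def toCompletion : 𝒜 →⋆ₐ[ℂ] p.Completion where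
  toFun a := ((show p.Carrier from a : p.Carrier) : UniformSpace.Completion p.Carrier)
  map_one' := rfl
  map_mul' a b := UniformSpace.Completion.coe_mul (α := p.Carrier) a b
  map_zero' := rfl
  map_add' a b := UniformSpace.Completion.coe_add (α := p.Carrier) a b
  commutes' _ := rfl
  map_star' a := (UniformSpace.Completion.map_coe
    (star_isometry (E := p.Carrier)).uniformContinuous (show p.Carrier from a)).symm

theorem norm_toCompletion (a : 𝒜) : ‖p.toCompletion a‖ = p a :=
  UniformSpace.Completion.norm_coe (E := p.Carrier) a

theorem denseRange_toCompletion : DenseRange p.toCompletion :=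
  UniformSpace.Completion.denseRange_coe (α := p.Carrier)

theorem induction_completion {P : p.Completion → Prop} (x : p.Completion)
    (hc : IsClosed {x | P x}) (h : ∀ a, P (p.toCompletion a)) : P x :=
  p.denseRange_toCompletion.induction_on x hc h

/-- The extension to the completion of a `*`-homomorphism that is contractive for `p`. -/
noncomputable def lift {B : Type*} [CStarAlgebra B] (f : 𝒜 →⋆ₐ[ℂ] B) (hf : ∀ a, ‖f a‖ ≤ p a) :
    p.Completion →⋆ₐ[ℂ] B :=
  let F : p.Carrier →L[ℂ] B := LinearMap.mkContinuous
    (show p.Carrier →ₗ[ℂ] B from f.toAlgHom.toLinearMap) 1 (fun a => by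
      rw [one_mul]; exact hf a)
  let G : p.Completion →L[ℂ] B := F.fromCompletion
  have hG : ∀ a : 𝒜, G (p.toCompletion a) = f a := fun a =>
    F.fromCompletion_apply_coe (show p.Carrier from a)
  { toFun := G
    map_one' := by rw [← map_one p.toCompletion, hG, map_one]
    map_mul' := fun x y => by
      refine p.induction_completion (P := fun x => G (x * y) = G x * G y) x
        (isClosed_eq (by fun_prop) (by fun_prop)) fun a => ?_
      refine p.induction_completion
        (P := fun y => G (p.toCompletion a * y) = G (p.toCompletion a) * G y) y
        (isClosed_eq (by fun_prop) (by fun_prop)) fun b => ?_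
      rw [← map_mul, hG, hG, hG, map_mul]
    map_zero' := map_zero G
    map_add' := map_add G
    commutes' := fun c => by
      rw [← AlgHomClass.commutes p.toCompletion, hG, AlgHomClass.commutes]
    map_star' := fun x => by
      refine p.induction_completion (P := fun x => G (star x) = star (G x)) x
        (isClosed_eq (by fun_prop) (by fun_prop)) fun a => ?_
      rw [← map_star, hG, hG, map_star] }

theorem lift_toCompletion {B : Type*} [CStarAlgebra B] (f : 𝒜 →⋆ₐ[ℂ] B)
    (hf : ∀ a, ‖f a‖ ≤ p a) (a : 𝒜) : p.lift f hf (p.toCompletion a) = f a :=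
  ContinuousLinearMap.fromCompletion_apply_coe (α := p.Carrier) _ a

end CStarSeminorm

end CStarSeminorm

/-! ### Universal C⋆-algebras -/

section Universal

/-- The C⋆-algebra of bounded operators on a Hilbert space. -/
def BoundedOp (H : Type*) [NormedAddCommGroup H] [InnerProductSpace ℂ H] : Type _ := H →L[ℂ] H

namespace BoundedOp

variable {H : Type*} [NormedAddCommGroup H] [InnerProductSpace ℂ H]

/-- The underlying operator. -/
def toCLM (S : BoundedOp H) : H →L[ℂ] H := S

/-- A bounded operator as an element of the C⋆-algebra of bounded operators. -/
def ofCLM (S : H →L[ℂ] H) : BoundedOp H := S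

noncomputable instance [CompleteSpace H] : CStarAlgebra (BoundedOp H) :=
  inferInstanceAs (CStarAlgebra (H →L[ℂ] H))

theorem ext {S T : BoundedOp H} (h : ∀ x, S.toCLM x = T.toCLM x) : S = T :=
  ContinuousLinearMap.ext h

variable [CompleteSpace H]

theorem toCLM_one (x : H) : (1 : BoundedOp H).toCLM x = x := rfl
theorem toCLM_zero (x : H) : (0 : BoundedOp H).toCLM x = 0 := rfl
theorem toCLM_add (S T : BoundedOp H) (x : H) : (S + T).toCLM x = S.toCLM x + T.toCLM x := rfl
theorem toCLM_mul (S T : BoundedOp H) (x : H) : (S * T).toCLM x = S.toCLM (T.toCLM x) := rfl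
theorem toCLM_algebraMap (c : ℂ) (x : H) : (algebraMap ℂ (BoundedOp H) c).toCLM x = c • x := rfl
theorem toCLM_star (S : BoundedOp H) : (star S).toCLM = ContinuousLinearMap.adjoint S.toCLM := rfl
theorem norm_toCLM (S : BoundedOp H) : ‖S.toCLM‖ = ‖S‖ := rfl

theorem norm_one_le (H : Type*) [NormedAddCommGroup H] [InnerProductSpace ℂ H] [CompleteSpace H] :
    ‖(1 : BoundedOp H)‖ ≤ 1 :=
  ContinuousLinearMap.norm_id_le (𝕜 := ℂ) (E := H)

end BoundedOp

/-- The free complex unital `*`-algebra on a set `X`: noncommutative polynomials in the letters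
`x` (`Sum.inl x`) and `x*` (`Sum.inr x`). -/
abbrev FreeStarAlgebra (X : Type*) : Type _ := MonoidAlgebra ℂ (FreeMonoid (X ⊕ X))

namespace FreeStarAlgebra

variable {X : Type*}

/-- The letter `x` or `x*`. -/
noncomputable def letter (s : X ⊕ X) : FreeStarAlgebra X :=
  MonoidAlgebra.single (FreeMonoid.of s) 1

/-- The generator `x`. -/
noncomputable def gen (x : X) : FreeStarAlgebra X := letter (Sum.inl x)

/-- The involution as a ring homomorphism to the opposite ring: it conjugates scalars, exchanges
the letters `x` and `x*`, and reverses products. -/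
noncomputable def starHom : FreeStarAlgebra X →+* (FreeStarAlgebra X)ᵐᵒᵖ :=
  MonoidAlgebra.liftNCRingHom
    ((algebraMap ℂ (FreeStarAlgebra X)ᵐᵒᵖ).comp (starRingEnd ℂ))
    (FreeMonoid.lift fun s => MulOpposite.op (letter s.swap))
    (fun c _ => Algebra.commute_algebraMap_left (starRingEnd ℂ c) _)

theorem starHom_algebraMap (c : ℂ) :
    starHom (algebraMap ℂ (FreeStarAlgebra X) c) = algebraMap ℂ _ (starRingEnd ℂ c) := by
  refine (MonoidAlgebra.liftNCRingHom_single _ _ _ _ _).trans ?_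
  simp

theorem starHom_letter (s : X ⊕ X) :
    starHom (letter s) = MulOpposite.op (letter s.swap) := by
  refine (MonoidAlgebra.liftNCRingHom_single _ _ _ _ _).trans ?_
  rw [RingHom.comp_apply, map_one, map_one, one_mul, FreeMonoid.lift_eval_of]

theorem induction {P : FreeStarAlgebra X → Prop}
    (hs : ∀ c : ℂ, P (algebraMap ℂ _ c)) (hl : ∀ s, P (letter s))
    (ha : ∀ a b, P a → P b → P (a + b)) (hm : ∀ a b, P a → P b → P (a * b))
    (a : FreeStarAlgebra X) : P a := by
  have hw : ∀ w : FreeMonoid (X ⊕ X),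
      P (MonoidAlgebra.single w 1 : FreeStarAlgebra X) := fun w => by
    induction w using FreeMonoid.inductionOn' with
    | one => simpa using! hs 1
    | of_mul s w ih =>
      have := hm _ _ (hl s) ih
      have e : letter s * (MonoidAlgebra.single w 1 : FreeStarAlgebra X) =
          (MonoidAlgebra.single (FreeMonoid.of s * w) 1 : FreeStarAlgebra X) := by
        refine (MonoidAlgebra.single_mul_single ..).trans ?_
        simp
      rwa [e] at this
  refine MonoidAlgebra.induction_linear (motive := P) a ?_ ha ?_
  · simpa using! hs 0
  · intro w c
    have := hm _ _ (hs c) (hw w)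
    have e : algebraMap ℂ (FreeStarAlgebra X) c *
        (MonoidAlgebra.single w 1 : FreeStarAlgebra X) =
          (MonoidAlgebra.single w c : FreeStarAlgebra X) := by
      refine (MonoidAlgebra.single_mul_single ..).trans ?_
      simp
    rwa [e] at this

noncomputable instance : StarRing (FreeStarAlgebra X) where
  star a := (starHom a).unop
  star_involutive a := by
    refine induction (P := fun a => (starHom (starHom a).unop).unop = a) ?_ ?_ ?_ ?_ a
    · intro c
      rw [starHom_algebraMap, MulOpposite.algebraMap_apply, MulOpposite.unop_op,
        starHom_algebraMap, MulOpposite.algebraMap_apply, MulOpposite.unop_op, Complex.conj_conj]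
    · intro s
      simp [starHom_letter]
    · intro a b ha hb
      simp [ha, hb]
    · intro a b ha hb
      simp [ha, hb]
  star_mul a b := by simp
  star_add a b := by simp

instance : StarModule ℂ (FreeStarAlgebra X) where
  star_smul c a := by
    change (starHom (c • a)).unop = star c • (starHom a).unop
    rw [Algebra.smul_def, map_mul, starHom_algebraMap, MulOpposite.unop_mul, Algebra.smul_def]
    exact (Algebra.commutes _ _).symm

theorem star_gen (x : X) : star (gen x) = letter (Sum.inr x) := by
  change (starHom (letter (Sum.inl x))).unop = _
  rw [starHom_letter]
  rfl

end FreeStarAlgebra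

/-- The C⋆-seminorms `a ↦ ‖π a‖` of the representations `π` on Hilbert spaces of the generators
`X` subject to the relations `r = 0` for all `*`-polynomials `r` with `R r`. -/
def repSeminorms {X : Type u} (R : FreeStarAlgebra X → Prop) :
    Set (CStarSeminorm (FreeStarAlgebra X)) :=
  {p | ∃ (H : Type u) (_ : NormedAddCommGroup H) (_ : InnerProductSpace ℂ H)
    (_ : CompleteSpace H) (π : FreeStarAlgebra X →⋆ₐ[ℂ] BoundedOp H),
    (∀ r, R r → π r = 0) ∧ p = CStarSeminorm.ofHom π}

/-- The relations bound the norm of every generator, so that a universal C⋆-algebra exists. -/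
class BoundedRelations {X : Type u} (R : FreeStarAlgebra X → Prop) : Prop where
  bound : ∀ x, ∃ C, ∀ p ∈ repSeminorms R, p (FreeStarAlgebra.gen x) ≤ C

theorem BoundedRelations.bound_all {X : Type u} (R : FreeStarAlgebra X → Prop)
    [hR : BoundedRelations R] (a : FreeStarAlgebra X) : ∃ C, ∀ p ∈ repSeminorms R, p a ≤ C := by
  induction a using FreeStarAlgebra.induction with
  | hs c =>
    refine ⟨‖c‖, ?_⟩
    rintro _ ⟨H, _, _, _, π, -, rfl⟩
    change ‖π (algebraMap ℂ _ c)‖ ≤ ‖c‖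
    rw [AlgHomClass.commutes, Algebra.algebraMap_eq_smul_one, norm_smul]
    exact mul_le_of_le_one_right (norm_nonneg c) (BoundedOp.norm_one_le H)
  | hl s =>
    rcases s with x | x
    · exact hR.bound x
    · obtain ⟨C, hC⟩ := hR.bound x
      exact ⟨C, fun p hp => by rw [← FreeStarAlgebra.star_gen, p.star_eq]; exact hC p hp⟩
  | ha a b iha ihb =>
    obtain ⟨C, hC⟩ := iha
    obtain ⟨D, hD⟩ := ihb
    exact ⟨C + D, fun p hp => (p.add_le' a b).trans (add_le_add (hC p hp) (hD p hp))⟩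
  | hm a b iha ihb =>
    obtain ⟨C, hC⟩ := iha
    obtain ⟨D, hD⟩ := ihb
    exact ⟨C * D, fun p hp => (p.mul_le' a b).trans
      (mul_le_mul (hC p hp) (hD p hp) (p.nonneg b) ((p.nonneg a).trans (hC p hp)))⟩

/-- The supremum of the norm of `a` over all representations of the relations `R`. -/
noncomputable def universalSeminorm {X : Type u} (R : FreeStarAlgebra X → Prop)
    [BoundedRelations R] : CStarSeminorm (FreeStarAlgebra X) :=
  CStarSeminorm.sup (repSeminorms R) (BoundedRelations.bound_all R)

/-- The universal C⋆-algebra generated by `X` subject to the relations `R`. -/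
def UniversalCStar {X : Type u} (R : FreeStarAlgebra X → Prop) [BoundedRelations R] : Type u :=
  (universalSeminorm R).Completion

noncomputable instance {X : Type u} (R : FreeStarAlgebra X → Prop) [BoundedRelations R] :
    CStarAlgebra (UniversalCStar R) :=
  inferInstanceAs (CStarAlgebra (universalSeminorm R).Completion)

/-- The canonical map from the free `*`-algebra to the universal C⋆-algebra. -/
noncomputable def UniversalCStar.mk {X : Type u} (R : FreeStarAlgebra X → Prop)
    [BoundedRelations R] : FreeStarAlgebra X →⋆ₐ[ℂ] UniversalCStar R :=
  (universalSeminorm R).toCompletion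

/-- The canonical generators of the universal C⋆-algebra. -/
noncomputable def UniversalCStar.gen {X : Type u} (R : FreeStarAlgebra X → Prop)
    [BoundedRelations R] (x : X) : UniversalCStar R :=
  UniversalCStar.mk R (FreeStarAlgebra.gen x)

/-- Relations that make every generator a projection bound the generators. -/
theorem BoundedRelations.of_projections {X : Type u} {R : FreeStarAlgebra X → Prop}
    (hs : ∀ x, R (star (FreeStarAlgebra.gen x) - FreeStarAlgebra.gen x))
    (hi : ∀ x, R (FreeStarAlgebra.gen x * FreeStarAlgebra.gen x - FreeStarAlgebra.gen x)) :
    BoundedRelations R where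
  bound x := by
    refine ⟨1, ?_⟩
    rintro _ ⟨H, _, _, _, π, hπ, rfl⟩
    have h1 : star (π (FreeStarAlgebra.gen x)) = π (FreeStarAlgebra.gen x) := by
      have := hπ _ (hs x)
      rwa [map_sub, map_star, sub_eq_zero] at this
    have h2 : π (FreeStarAlgebra.gen x) * π (FreeStarAlgebra.gen x) =
        π (FreeStarAlgebra.gen x) := by
      have := hπ _ (hi x)
      rwa [map_sub, map_mul, sub_eq_zero] at this
    change ‖π (FreeStarAlgebra.gen x)‖ ≤ 1
    have h3 := CStarRing.norm_star_mul_self (x := π (FreeStarAlgebra.gen x))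
    rw [h1, h2] at h3
    by_contra hlt
    nlinarith

end Universal

/-! ### The minimal tensor product of C⋆-algebras -/

section MinTensor

section Algebraic

variable {𝒜 ℬ B : Type*} [Ring 𝒜] [StarRing 𝒜] [Algebra ℂ 𝒜] [StarModule ℂ 𝒜]
  [Ring ℬ] [StarRing ℬ] [Algebra ℂ ℬ] [StarModule ℂ ℬ]
  [Ring B] [StarRing B] [Algebra ℂ B]

/-- The `*`-homomorphism `a ⊗ b ↦ f a * g b` on the algebraic tensor product, for `*`-homomorphisms
`f`, `g` with commuting ranges. -/
noncomputable def tensorLift (f : 𝒜 →⋆ₐ[ℂ] B) (g : ℬ →⋆ₐ[ℂ] B) (h : ∀ a b, Commute (f a) (g b)) :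
    𝒜 ⊗[ℂ] ℬ →⋆ₐ[ℂ] B :=
  { Algebra.TensorProduct.lift f.toAlgHom g.toAlgHom h with
    map_star' := fun x => by
      change Algebra.TensorProduct.lift f.toAlgHom g.toAlgHom h (star x) =
        star (Algebra.TensorProduct.lift f.toAlgHom g.toAlgHom h x)
      induction x using TensorProduct.induction_on with
      | zero => simp
      | tmul a b =>
        simp only [TensorProduct.star_tmul, Algebra.TensorProduct.lift_tmul]
        change f (star a) * g (star b) = star (f a * g b)
        rw [star_mul, map_star, map_star, ← map_star f, ← map_star g, (h _ _).eq]
      | add x y hx hy => simp only [star_add, map_add, hx, hy] }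

theorem tensorLift_tmul (f : 𝒜 →⋆ₐ[ℂ] B) (g : ℬ →⋆ₐ[ℂ] B) (h : ∀ a b, Commute (f a) (g b))
    (a : 𝒜) (b : ℬ) : tensorLift f g h (a ⊗ₜ b) = f a * g b :=
  Algebra.TensorProduct.lift_tmul f.toAlgHom g.toAlgHom h a b

variable (𝒜 ℬ)

/-- `a ↦ a ⊗ 1`. -/
noncomputable def inclLeft : 𝒜 →⋆ₐ[ℂ] 𝒜 ⊗[ℂ] ℬ :=
  { (Algebra.TensorProduct.includeLeft : 𝒜 →ₐ[ℂ] 𝒜 ⊗[ℂ] ℬ) with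
    map_star' := fun a => by
      change star a ⊗ₜ[ℂ] (1 : ℬ) = star (a ⊗ₜ[ℂ] (1 : ℬ))
      simp }

/-- `b ↦ 1 ⊗ b`. -/
noncomputable def inclRight : ℬ →⋆ₐ[ℂ] 𝒜 ⊗[ℂ] ℬ :=
  { (Algebra.TensorProduct.includeRight : ℬ →ₐ[ℂ] 𝒜 ⊗[ℂ] ℬ) with
    map_star' := fun b => by
      change (1 : 𝒜) ⊗ₜ[ℂ] star b = star ((1 : 𝒜) ⊗ₜ[ℂ] b)
      simp }

variable {𝒜 ℬ}

theorem inclLeft_apply (a : 𝒜) : inclLeft 𝒜 ℬ a = a ⊗ₜ 1 := rfl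
theorem inclRight_apply (b : ℬ) : inclRight 𝒜 ℬ b = 1 ⊗ₜ b := rfl

end Algebraic

section Hilbert

variable {H K L : Type*} [NormedAddCommGroup H] [InnerProductSpace ℂ H]
  [NormedAddCommGroup K] [InnerProductSpace ℂ K]
  [NormedAddCommGroup L] [InnerProductSpace ℂ L]

/-- The Hilbert space tensor product. -/
abbrev HilbertTensor (H K : Type*) [NormedAddCommGroup H] [InnerProductSpace ℂ H]
    [NormedAddCommGroup K] [InnerProductSpace ℂ K] : Type _ :=
  UniformSpace.Completion (H ⊗[ℂ] K)

/-- The elementary tensor of two vectors in the Hilbert space tensor product. -/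
noncomputable def vtmul (h : H) (k : K) : HilbertTensor H K := ((h ⊗ₜ[ℂ] k : H ⊗[ℂ] K) : _)

theorem HilbertTensor.ext {E : Type*} [NormedAddCommGroup E] [NormedSpace ℂ E]
    {F G : HilbertTensor H K →L[ℂ] E} (h : ∀ x y, F (vtmul x y) = G (vtmul x y)) : F = G := by
  ext z
  refine UniformSpace.Completion.induction_on z
    (isClosed_eq F.continuous G.continuous) fun w => ?_
  induction w using TensorProduct.induction_on with
  | zero => rw [UniformSpace.Completion.coe_zero, map_zero, map_zero]
  | tmul x y => exact h x y
  | add x y hx hy => rw [UniformSpace.Completion.coe_add, map_add, map_add, hx, hy]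

/-- The operator `S ⊗ T` on the Hilbert space tensor product. -/
noncomputable def opTensor (S : H →L[ℂ] H) (T : K →L[ℂ] K) :
    HilbertTensor H K →L[ℂ] HilbertTensor H K :=
  (TensorProduct.mapL S T).completion

theorem opTensor_vtmul (S : H →L[ℂ] H) (T : K →L[ℂ] K) (x : H) (y : K) :
    opTensor S T (vtmul x y) = vtmul (S x) (T y) := by
  rw [opTensor, vtmul, ContinuousLinearMap.completion_apply_coe, TensorProduct.mapL_tmul]
  rfl

theorem inner_vtmul (x x' : H) (y y' : K) :
    inner ℂ (vtmul x y) (vtmul x' y') = inner ℂ x x' * inner ℂ y y' := by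
  rw [vtmul, vtmul, UniformSpace.Completion.inner_coe, TensorProduct.inner_tmul]

/-- The algebraic triple tensor product, inside the iterated Hilbert space tensor product. -/
noncomputable def tripleIncl (H K L : Type*) [NormedAddCommGroup H] [InnerProductSpace ℂ H]
    [NormedAddCommGroup K] [InnerProductSpace ℂ K] [NormedAddCommGroup L] [InnerProductSpace ℂ L] :
    (H ⊗[ℂ] K) ⊗[ℂ] L →ₗᵢ[ℂ] HilbertTensor (HilbertTensor H K) L :=
  UniformSpace.Completion.toComplₗᵢ.comp
    (TensorProduct.mapIsometry UniformSpace.Completion.toComplₗᵢ LinearIsometry.id)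

theorem denseRange_tripleIncl : DenseRange (tripleIncl H K L) := by
  refine DenseRange.comp (g := ((↑) : HilbertTensor H K ⊗[ℂ] L → HilbertTensor (HilbertTensor H K) L))
    UniformSpace.Completion.denseRange_coe ?_ (UniformSpace.Completion.continuous_coe _)
  let T : (H ⊗[ℂ] K) ⊗[ℂ] L →ₗᵢ[ℂ] HilbertTensor H K ⊗[ℂ] L :=
    TensorProduct.mapIsometry UniformSpace.Completion.toComplₗᵢ LinearIsometry.id
  have key : ∀ w, w ∈ T.toLinearMap.toAddMonoidHom.range.topologicalClosure := fun w => by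
    induction w using TensorProduct.induction_on with
    | zero => exact zero_mem _
    | add x y hx hy => exact add_mem hx hy
    | tmul z l =>
      refine UniformSpace.Completion.induction_on z ?_ fun x => ?_
      · exact (AddSubgroup.isClosed_topologicalClosure _).preimage
          (TensorProduct.continuous_tmul.comp
            (continuous_id.prodMk continuous_const : Continuous fun z : HilbertTensor H K => (z, l)))
      · exact AddSubgroup.le_topologicalClosure _ ⟨x ⊗ₜ l, rfl⟩
  intro w
  exact key w

theorem HilbertTensor.ext₃ {E : Type*} [NormedAddCommGroup E] [NormedSpace ℂ E]
    {F G : HilbertTensor (HilbertTensor H K) L →L[ℂ] E}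
    (h : ∀ x y z, F (vtmul (vtmul x y) z) = G (vtmul (vtmul x y) z)) : F = G := by
  have h' : F.toLinearMap ∘ₗ (tripleIncl H K L).toLinearMap =
      G.toLinearMap ∘ₗ (tripleIncl H K L).toLinearMap :=
    TensorProduct.ext_threefold h
  ext w
  refine denseRange_tripleIncl.induction_on w (isClosed_eq F.continuous G.continuous) fun v => ?_
  exact LinearMap.congr_fun h' v

/-- The canonical isometry between the two iterated Hilbert space tensor products. -/
theorem HilbertTensor.exists_assoc :
    ∃ J : HilbertTensor (HilbertTensor H K) L →ₗᵢ[ℂ] HilbertTensor H (HilbertTensor K L),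
      ∀ x y z, J (vtmul (vtmul x y) z) = vtmul x (vtmul y z) := by
  let f : (H ⊗[ℂ] K) ⊗[ℂ] L →ₗᵢ[ℂ] HilbertTensor H (HilbertTensor K L) :=
    (UniformSpace.Completion.toComplₗᵢ.comp
      (TensorProduct.mapIsometry LinearIsometry.id UniformSpace.Completion.toComplₗᵢ)).comp
      (TensorProduct.assocIsometry ℂ H K L).toLinearIsometry
  let J := f.toContinuousLinearMap.extend (tripleIncl H K L).toContinuousLinearMap
  have hJ : ∀ v, J (tripleIncl H K L v) = f v := fun v =>
    ContinuousLinearMap.extend_eq f.toContinuousLinearMap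
      (e := (tripleIncl H K L).toContinuousLinearMap) denseRange_tripleIncl
      (tripleIncl H K L).isometry.isUniformInducing v
  refine ⟨⟨J.toLinearMap, fun w => ?_⟩, fun x y z => hJ ((x ⊗ₜ y) ⊗ₜ z)⟩
  change ‖J w‖ = ‖w‖
  refine denseRange_tripleIncl.induction_on w (isClosed_eq J.continuous.norm continuous_norm)
    fun v => ?_
  rw [hJ, LinearIsometry.norm_map, LinearIsometry.norm_map]

theorem BoundedOp.ext_vtmul {S T : BoundedOp (HilbertTensor H K)}
    (h : ∀ x y, S.toCLM (vtmul x y) = T.toCLM (vtmul x y)) : S = T :=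
  HilbertTensor.ext h

variable [CompleteSpace H] [CompleteSpace K]

theorem adjoint_opTensor (S : H →L[ℂ] H) (T : K →L[ℂ] K) :
    ContinuousLinearMap.adjoint (opTensor S T) =
      opTensor (ContinuousLinearMap.adjoint S) (ContinuousLinearMap.adjoint T) := by
  refine HilbertTensor.ext fun x y => ?_
  refine ext_inner_left ℂ fun v => ?_
  rw [ContinuousLinearMap.adjoint_inner_right]
  refine UniformSpace.Completion.induction_on v
    (isClosed_eq ((opTensor S T).continuous.inner continuous_const)
      (continuous_id.inner continuous_const)) fun w => ?_
  induction w using TensorProduct.induction_on with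
  | zero => rw [UniformSpace.Completion.coe_zero, map_zero, inner_zero_left, inner_zero_left]
  | tmul x' y' =>
    change inner ℂ (opTensor S T (vtmul x' y')) _ = inner ℂ (vtmul x' y') _
    rw [opTensor_vtmul, opTensor_vtmul, inner_vtmul, inner_vtmul,
      ContinuousLinearMap.adjoint_inner_right, ContinuousLinearMap.adjoint_inner_right]
  | add w w' hw hw' =>
    rw [UniformSpace.Completion.coe_add, map_add, inner_add_left, inner_add_left, hw, hw']

variable (H K)

/-- `S ↦ S ⊗ 1`. -/
noncomputable def opLeft : BoundedOp H →⋆ₐ[ℂ] BoundedOp (HilbertTensor H K) where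
  toFun S := BoundedOp.ofCLM (opTensor S.toCLM (ContinuousLinearMap.id ℂ K))
  map_one' := BoundedOp.ext_vtmul fun x y => opTensor_vtmul _ _ x y
  map_mul' S T := BoundedOp.ext_vtmul fun x y => by
    rw [BoundedOp.toCLM_mul]
    change opTensor _ _ (vtmul x y) = opTensor _ _ (opTensor _ _ (vtmul x y))
    rw [opTensor_vtmul, opTensor_vtmul, opTensor_vtmul]
    rfl
  map_zero' := BoundedOp.ext_vtmul fun x y => by
    refine (opTensor_vtmul _ _ x y).trans ?_
    rw [BoundedOp.toCLM_zero, BoundedOp.toCLM_zero, vtmul, TensorProduct.zero_tmul]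
    rfl
  map_add' S T := BoundedOp.ext_vtmul fun x y => by
    rw [BoundedOp.toCLM_add]
    refine (opTensor_vtmul _ _ x y).trans ?_
    refine Eq.trans ?_ (congrArg₂ (· + ·) (opTensor_vtmul S.toCLM _ x y).symm
      (opTensor_vtmul T.toCLM _ x y).symm)
    rw [BoundedOp.toCLM_add, vtmul, TensorProduct.add_tmul, UniformSpace.Completion.coe_add]
    rfl
  commutes' c := BoundedOp.ext_vtmul fun x y => by
    refine (opTensor_vtmul _ _ x y).trans ?_
    rw [BoundedOp.toCLM_algebraMap, BoundedOp.toCLM_algebraMap, vtmul,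
      ← TensorProduct.smul_tmul', UniformSpace.Completion.coe_smul]
    rfl
  map_star' S := by
    refine Eq.trans ?_ (adjoint_opTensor S.toCLM (ContinuousLinearMap.id ℂ K)).symm
    rw [ContinuousLinearMap.adjoint_id]
    rfl

/-- `T ↦ 1 ⊗ T`. -/
noncomputable def opRight : BoundedOp K →⋆ₐ[ℂ] BoundedOp (HilbertTensor H K) where
  toFun T := BoundedOp.ofCLM (opTensor (ContinuousLinearMap.id ℂ H) T.toCLM)
  map_one' := BoundedOp.ext_vtmul fun x y => opTensor_vtmul _ _ x y
  map_mul' S T := BoundedOp.ext_vtmul fun x y => by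
    rw [BoundedOp.toCLM_mul]
    change opTensor _ _ (vtmul x y) = opTensor _ _ (opTensor _ _ (vtmul x y))
    rw [opTensor_vtmul, opTensor_vtmul, opTensor_vtmul]
    rfl
  map_zero' := BoundedOp.ext_vtmul fun x y => by
    refine (opTensor_vtmul _ _ x y).trans ?_
    rw [BoundedOp.toCLM_zero, BoundedOp.toCLM_zero, vtmul, TensorProduct.tmul_zero]
    rfl
  map_add' S T := BoundedOp.ext_vtmul fun x y => by
    rw [BoundedOp.toCLM_add]
    refine (opTensor_vtmul _ _ x y).trans ?_
    refine Eq.trans ?_ (congrArg₂ (· + ·) (opTensor_vtmul _ S.toCLM x y).symm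
      (opTensor_vtmul _ T.toCLM x y).symm)
    rw [BoundedOp.toCLM_add, vtmul, TensorProduct.tmul_add, UniformSpace.Completion.coe_add]
    rfl
  commutes' c := BoundedOp.ext_vtmul fun x y => by
    refine (opTensor_vtmul _ _ x y).trans ?_
    rw [BoundedOp.toCLM_algebraMap, BoundedOp.toCLM_algebraMap, vtmul,
      TensorProduct.tmul_smul, UniformSpace.Completion.coe_smul]
    rfl
  map_star' S := by
    refine Eq.trans ?_ (adjoint_opTensor (ContinuousLinearMap.id ℂ H) S.toCLM).symm
    rw [ContinuousLinearMap.adjoint_id]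
    rfl

variable {H K}

theorem opLeft_vtmul (S : BoundedOp H) (x : H) (y : K) :
    (opLeft H K S).toCLM (vtmul x y) = vtmul (S.toCLM x) y :=
  opTensor_vtmul S.toCLM (ContinuousLinearMap.id ℂ K) x y

theorem opRight_vtmul (T : BoundedOp K) (x : H) (y : K) :
    (opRight H K T).toCLM (vtmul x y) = vtmul x (T.toCLM y) :=
  opTensor_vtmul (ContinuousLinearMap.id ℂ H) T.toCLM x y

theorem opLeft_commute_opRight (S : BoundedOp H) (T : BoundedOp K) :
    Commute (opLeft H K S) (opRight H K T) :=
  BoundedOp.ext_vtmul fun x y => by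
    rw [BoundedOp.toCLM_mul, BoundedOp.toCLM_mul, opLeft_vtmul, opRight_vtmul, opRight_vtmul,
      opLeft_vtmul]

/-- The tensor product `π ⊗ σ` of two representations, on the Hilbert space tensor product:
`a ⊗ b` acts as `π a ⊗ σ b`. -/
noncomputable def tensorRep {𝒜 ℬ : Type*} [Ring 𝒜] [StarRing 𝒜] [Algebra ℂ 𝒜] [StarModule ℂ 𝒜]
    [Ring ℬ] [StarRing ℬ] [Algebra ℂ ℬ] [StarModule ℂ ℬ]
    (π : 𝒜 →⋆ₐ[ℂ] BoundedOp H) (σ : ℬ →⋆ₐ[ℂ] BoundedOp K) :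
    𝒜 ⊗[ℂ] ℬ →⋆ₐ[ℂ] BoundedOp (HilbertTensor H K) :=
  tensorLift ((opLeft H K).comp π) ((opRight H K).comp σ)
    fun a b => opLeft_commute_opRight (π a) (σ b)

theorem tensorRep_tmul {𝒜 ℬ : Type*} [Ring 𝒜] [StarRing 𝒜] [Algebra ℂ 𝒜] [StarModule ℂ 𝒜]
    [Ring ℬ] [StarRing ℬ] [Algebra ℂ ℬ] [StarModule ℂ ℬ]
    (π : 𝒜 →⋆ₐ[ℂ] BoundedOp H) (σ : ℬ →⋆ₐ[ℂ] BoundedOp K) (a : 𝒜) (b : ℬ) :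
    tensorRep π σ (a ⊗ₜ b) = opLeft H K (π a) * opRight H K (σ b) :=
  tensorLift_tmul ..

end Hilbert

section Binary

variable (A B : Type u) [CStarAlgebra A] [CStarAlgebra B]

/-- The seminorms `x ↦ ‖(π ⊗ σ) x‖` on the algebraic tensor product, for all representations
`π` of `A` and `σ` of `B` on Hilbert spaces. -/
def productSeminorms : Set (CStarSeminorm (A ⊗[ℂ] B)) :=
  {p | ∃ (H K : Type u) (_ : NormedAddCommGroup H) (_ : InnerProductSpace ℂ H)
    (_ : CompleteSpace H) (_ : NormedAddCommGroup K) (_ : InnerProductSpace ℂ K)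
    (_ : CompleteSpace K) (π : A →⋆ₐ[ℂ] BoundedOp H) (σ : B →⋆ₐ[ℂ] BoundedOp K),
    p = CStarSeminorm.ofHom (tensorRep π σ)}

theorem norm_tensorRep_tmul_le {A B H K : Type*} [CStarAlgebra A] [CStarAlgebra B]
    [NormedAddCommGroup H] [InnerProductSpace ℂ H] [CompleteSpace H]
    [NormedAddCommGroup K] [InnerProductSpace ℂ K] [CompleteSpace K]
    (π : A →⋆ₐ[ℂ] BoundedOp H) (σ : B →⋆ₐ[ℂ] BoundedOp K) (a : A) (b : B) :
    ‖tensorRep π σ (a ⊗ₜ b)‖ ≤ ‖a‖ * ‖b‖ := by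
  rw [tensorRep_tmul]
  exact (norm_mul_le _ _).trans (mul_le_mul
    (NonUnitalStarAlgHom.norm_apply_le ((opLeft H K).comp π) a)
    (NonUnitalStarAlgHom.norm_apply_le ((opRight H K).comp σ) b)
    (norm_nonneg _) (norm_nonneg _))

theorem productSeminorms_bounded (x : A ⊗[ℂ] B) : ∃ C, ∀ p ∈ productSeminorms A B, p x ≤ C := by
  induction x using TensorProduct.induction_on with
  | zero => exact ⟨0, fun p _ => p.map_zero'.le⟩
  | tmul a b =>
    refine ⟨‖a‖ * ‖b‖, ?_⟩
    rintro _ ⟨H, K, _, _, _, _, _, _, π, σ, rfl⟩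
    exact norm_tensorRep_tmul_le π σ a b
  | add x y hx hy =>
    obtain ⟨C, hC⟩ := hx
    obtain ⟨D, hD⟩ := hy
    exact ⟨C + D, fun p hp => (p.add_le' x y).trans (add_le_add (hC p hp) (hD p hp))⟩

/-- The minimal (spatial) C⋆-norm on the algebraic tensor product. -/
noncomputable def minSeminorm : CStarSeminorm (A ⊗[ℂ] B) :=
  CStarSeminorm.sup (productSeminorms A B) (productSeminorms_bounded A B)

/-- The minimal tensor product of two C⋆-algebras. -/
abbrev MinTensor : Type u := (minSeminorm A B).Completion

variable {A B}

/-- The elementary tensor `a ⊗ b` in the minimal tensor product. -/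
noncomputable def mtmul (a : A) (b : B) : MinTensor A B :=
  (minSeminorm A B).toCompletion (a ⊗ₜ b)

theorem norm_tensorRep_le {H K : Type u} [NormedAddCommGroup H] [InnerProductSpace ℂ H]
    [CompleteSpace H] [NormedAddCommGroup K] [InnerProductSpace ℂ K] [CompleteSpace K]
    (π : A →⋆ₐ[ℂ] BoundedOp H) (σ : B →⋆ₐ[ℂ] BoundedOp K) (x : A ⊗[ℂ] B) :
    ‖tensorRep π σ x‖ ≤ minSeminorm A B x :=
  CStarSeminorm.le_sup (productSeminorms_bounded A B) ⟨H, K, _, _, _, _, _, _, π, σ, rfl⟩ x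

/-- The representation `π ⊗ σ` of the minimal tensor product. -/
noncomputable def minRep {H K : Type u} [NormedAddCommGroup H] [InnerProductSpace ℂ H]
    [CompleteSpace H] [NormedAddCommGroup K] [InnerProductSpace ℂ K] [CompleteSpace K]
    (π : A →⋆ₐ[ℂ] BoundedOp H) (σ : B →⋆ₐ[ℂ] BoundedOp K) :
    MinTensor A B →⋆ₐ[ℂ] BoundedOp (HilbertTensor H K) :=
  (minSeminorm A B).lift (tensorRep π σ) (norm_tensorRep_le π σ)

theorem minRep_coe {H K : Type u} [NormedAddCommGroup H] [InnerProductSpace ℂ H]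
    [CompleteSpace H] [NormedAddCommGroup K] [InnerProductSpace ℂ K] [CompleteSpace K]
    (π : A →⋆ₐ[ℂ] BoundedOp H) (σ : B →⋆ₐ[ℂ] BoundedOp K) (x : A ⊗[ℂ] B) :
    minRep π σ ((minSeminorm A B).toCompletion x) = tensorRep π σ x :=
  CStarSeminorm.lift_toCompletion _ _ _ _

end Binary

section Ternary

variable (A B C : Type u) [CStarAlgebra A] [CStarAlgebra B] [CStarAlgebra C]

/-- The seminorms `x ↦ ‖((π ⊗ σ) ⊗ τ) x‖` on the algebraic triple tensor product. -/
def productSeminorms₃ : Set (CStarSeminorm ((A ⊗[ℂ] B) ⊗[ℂ] C)) :=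
  {p | ∃ (H K L : Type u) (_ : NormedAddCommGroup H) (_ : InnerProductSpace ℂ H)
    (_ : CompleteSpace H) (_ : NormedAddCommGroup K) (_ : InnerProductSpace ℂ K)
    (_ : CompleteSpace K) (_ : NormedAddCommGroup L) (_ : InnerProductSpace ℂ L)
    (_ : CompleteSpace L) (π : A →⋆ₐ[ℂ] BoundedOp H) (σ : B →⋆ₐ[ℂ] BoundedOp K)
    (τ : C →⋆ₐ[ℂ] BoundedOp L),
    p = CStarSeminorm.ofHom (tensorRep (tensorRep π σ) τ)}

theorem productSeminorms₃_bounded (x : (A ⊗[ℂ] B) ⊗[ℂ] C) :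
    ∃ M, ∀ p ∈ productSeminorms₃ A B C, p x ≤ M := by
  induction x using TensorProduct.induction_on with
  | zero => exact ⟨0, fun p _ => p.map_zero'.le⟩
  | tmul y c =>
    refine ⟨minSeminorm A B y * ‖c‖, ?_⟩
    rintro _ ⟨H, K, L, _, _, _, _, _, _, _, _, _, π, σ, τ, rfl⟩
    change ‖tensorRep (tensorRep π σ) τ (y ⊗ₜ c)‖ ≤ _
    rw [tensorRep_tmul]
    refine (norm_mul_le _ _).trans (mul_le_mul ?_
      (NonUnitalStarAlgHom.norm_apply_le ((opRight (HilbertTensor H K) L).comp τ) c)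
      (norm_nonneg _) ((minSeminorm A B).nonneg y))
    exact (NonUnitalStarAlgHom.norm_apply_le (opLeft (HilbertTensor H K) L)
      (tensorRep π σ y)).trans (norm_tensorRep_le π σ y)
  | add x y hx hy =>
    obtain ⟨M, hM⟩ := hx
    obtain ⟨N, hN⟩ := hy
    exact ⟨M + N, fun p hp => (p.add_le' x y).trans (add_le_add (hM p hp) (hN p hp))⟩

/-- The minimal (spatial) C⋆-norm on the algebraic triple tensor product. -/
noncomputable def minSeminorm₃ : CStarSeminorm ((A ⊗[ℂ] B) ⊗[ℂ] C) :=
  CStarSeminorm.sup (productSeminorms₃ A B C) (productSeminorms₃_bounded A B C)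

/-- The minimal tensor product of three C⋆-algebras. -/
abbrev MinTensor₃ : Type u := (minSeminorm₃ A B C).Completion

variable {A B C}

section Rep

variable {H K L : Type u} [NormedAddCommGroup H] [InnerProductSpace ℂ H] [CompleteSpace H]
  [NormedAddCommGroup K] [InnerProductSpace ℂ K] [CompleteSpace K]
  [NormedAddCommGroup L] [InnerProductSpace ℂ L] [CompleteSpace L]
  (π : A →⋆ₐ[ℂ] BoundedOp H) (σ : B →⋆ₐ[ℂ] BoundedOp K) (τ : C →⋆ₐ[ℂ] BoundedOp L)

theorem norm_tensorRep₃_le (x : (A ⊗[ℂ] B) ⊗[ℂ] C) :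
    ‖tensorRep (tensorRep π σ) τ x‖ ≤ minSeminorm₃ A B C x :=
  CStarSeminorm.le_sup (productSeminorms₃_bounded A B C)
    ⟨H, K, L, _, _, _, _, _, _, _, _, _, π, σ, τ, rfl⟩ x

/-- The representation `(π ⊗ σ) ⊗ τ` of the minimal triple tensor product. -/
noncomputable def minRep₃ : MinTensor₃ A B C →⋆ₐ[ℂ]
    BoundedOp (HilbertTensor (HilbertTensor H K) L) :=
  (minSeminorm₃ A B C).lift (tensorRep (tensorRep π σ) τ) (norm_tensorRep₃_le π σ τ)

theorem minRep₃_coe (x : (A ⊗[ℂ] B) ⊗[ℂ] C) :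
    minRep₃ π σ τ ((minSeminorm₃ A B C).toCompletion x) = tensorRep (tensorRep π σ) τ x :=
  CStarSeminorm.lift_toCompletion _ _ _ _

end Rep

/-- The norm of the triple tensor product is computed by the representations `(π ⊗ σ) ⊗ τ`. -/
theorem MinTensor₃.norm_le {y : MinTensor₃ A B C} {M : ℝ} (hM : 0 ≤ M)
    (h : ∀ (H K L : Type u) [NormedAddCommGroup H] [InnerProductSpace ℂ H] [CompleteSpace H]
      [NormedAddCommGroup K] [InnerProductSpace ℂ K] [CompleteSpace K]
      [NormedAddCommGroup L] [InnerProductSpace ℂ L] [CompleteSpace L]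
      (π : A →⋆ₐ[ℂ] BoundedOp H) (σ : B →⋆ₐ[ℂ] BoundedOp K) (τ : C →⋆ₐ[ℂ] BoundedOp L),
      ‖minRep₃ π σ τ y‖ ≤ M) : ‖y‖ ≤ M := by
  refine le_of_forall_pos_le_add fun ε hε => ?_
  obtain ⟨x, hx⟩ := (minSeminorm₃ A B C).denseRange_toCompletion.exists_dist_lt y (half_pos hε)
  rw [dist_eq_norm] at hx
  set z := (minSeminorm₃ A B C).toCompletion x with hz
  have h1 : ‖z‖ ≤ M + ε / 2 := by
    rw [hz, CStarSeminorm.norm_toCompletion]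
    refine CStarSeminorm.sup_le _ (by positivity) ?_
    rintro _ ⟨H, K, L, _, _, _, _, _, _, _, _, _, π, σ, τ, rfl⟩
    change ‖tensorRep (tensorRep π σ) τ x‖ ≤ _
    rw [← minRep₃_coe, ← hz]
    have h2 : ‖minRep₃ π σ τ (y - z)‖ ≤ ‖y - z‖ := NonUnitalStarAlgHom.norm_apply_le _ _
    have h3 : minRep₃ π σ τ z = minRep₃ π σ τ y - minRep₃ π σ τ (y - z) := by
      rw [map_sub]; abel
    rw [h3]
    have := norm_sub_le (minRep₃ π σ τ y) (minRep₃ π σ τ (y - z))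
    have := h H K L π σ τ
    linarith
  have h4 : ‖y‖ ≤ ‖y - z‖ + ‖z‖ := by simpa using norm_add_le (y - z) z
  linarith

theorem continuous_starAlgHom {A B : Type*} [CStarAlgebra A] [CStarAlgebra B] (f : A →⋆ₐ[ℂ] B) :
    Continuous f :=
  AddMonoidHomClass.continuous_of_bound f 1 fun a => by
    rw [one_mul]; exact NonUnitalStarAlgHom.norm_apply_le f a

theorem BoundedOp.continuous_apply {H : Type*} [NormedAddCommGroup H] [InnerProductSpace ℂ H]
    [CompleteSpace H] (v : H) : Continuous fun S : BoundedOp H => S.toCLM v :=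
  (ContinuousLinearMap.apply ℂ H v).continuous

/-- `x ↦ x ⊗ 1`, from `A ⊗ B` to `A ⊗ B ⊗ C`. -/
noncomputable def leg₁₂ : MinTensor A B →⋆ₐ[ℂ] MinTensor₃ A B C :=
  (minSeminorm A B).lift
    ((minSeminorm₃ A B C).toCompletion.comp (inclLeft (A ⊗[ℂ] B) C)) fun x => by
      refine MinTensor₃.norm_le ((minSeminorm A B).nonneg x) ?_
      intro H K L _ _ _ _ _ _ _ _ _ π σ τ
      rw [StarAlgHom.comp_apply, minRep₃_coe, inclLeft_apply, tensorRep_tmul, map_one, map_one,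
        mul_one]
      exact (NonUnitalStarAlgHom.norm_apply_le (opLeft (HilbertTensor H K) L)
        (tensorRep π σ x)).trans (norm_tensorRep_le π σ x)

theorem leg₁₂_coe (x : A ⊗[ℂ] B) :
    leg₁₂ ((minSeminorm A B).toCompletion x) =
      (minSeminorm₃ A B C).toCompletion (x ⊗ₜ (1 : C)) :=
  CStarSeminorm.lift_toCompletion _ _ _ _

/-- `c ↦ 1 ⊗ 1 ⊗ c`. -/
noncomputable def leg₃ : C →⋆ₐ[ℂ] MinTensor₃ A B C :=
  (minSeminorm₃ A B C).toCompletion.comp (inclRight (A ⊗[ℂ] B) C)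

theorem leg₃_apply (c : C) :
    leg₃ c = (minSeminorm₃ A B C).toCompletion ((1 : A ⊗[ℂ] B) ⊗ₜ c) := rfl

/-- `a ↦ a ⊗ 1 ⊗ 1`. -/
noncomputable def leg₁ : A →⋆ₐ[ℂ] MinTensor₃ A B C :=
  (minSeminorm₃ A B C).toCompletion.comp ((inclLeft (A ⊗[ℂ] B) C).comp (inclLeft A B))

theorem leg₁_apply (a : A) :
    leg₁ a = (minSeminorm₃ A B C).toCompletion ((a ⊗ₜ[ℂ] (1 : B)) ⊗ₜ[ℂ] (1 : C)) := rfl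

/-- `b ⊗ c ↦ 1 ⊗ b ⊗ c` on the algebraic tensor product. -/
noncomputable def algLeg₂₃ : B ⊗[ℂ] C →⋆ₐ[ℂ] (A ⊗[ℂ] B) ⊗[ℂ] C :=
  tensorLift (B := (A ⊗[ℂ] B) ⊗[ℂ] C) ((inclLeft (A ⊗[ℂ] B) C).comp (inclRight A B))
    (inclRight (A ⊗[ℂ] B) C) fun b c => by
      change ((1 ⊗ₜ b : A ⊗[ℂ] B) ⊗ₜ[ℂ] (1 : C)) * (1 ⊗ₜ c) = (1 ⊗ₜ c) * ((1 ⊗ₜ b) ⊗ₜ 1)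
      simp

theorem algLeg₂₃_tmul (b : B) (c : C) :
    algLeg₂₃ (b ⊗ₜ[ℂ] c) = ((1 : A) ⊗ₜ[ℂ] b) ⊗ₜ[ℂ] c := by
  rw [algLeg₂₃, tensorLift_tmul]
  change ((1 ⊗ₜ b : A ⊗[ℂ] B) ⊗ₜ[ℂ] (1 : C)) * (1 ⊗ₜ c) = _
  simp

section Intertwine

theorem norm_le_of_intertwine {H K L : Type*} [NormedAddCommGroup H] [InnerProductSpace ℂ H]
    [NormedAddCommGroup K] [InnerProductSpace ℂ K] [NormedAddCommGroup L] [InnerProductSpace ℂ L]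
    (J : HilbertTensor (HilbertTensor H K) L →ₗᵢ[ℂ] HilbertTensor H (HilbertTensor K L))
    (X : BoundedOp (HilbertTensor (HilbertTensor H K) L))
    (Y : BoundedOp (HilbertTensor H (HilbertTensor K L)))
    (h : ∀ v, J (X.toCLM v) = Y.toCLM (J v)) : ‖X‖ ≤ ‖Y‖ :=
  X.toCLM.opNorm_le_bound (norm_nonneg _) fun v => by
    rw [← J.norm_map (X.toCLM v), h, ← J.norm_map v]
    exact Y.toCLM.le_opNorm _

variable {H K L : Type u} [NormedAddCommGroup H] [InnerProductSpace ℂ H] [CompleteSpace H]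
  [NormedAddCommGroup K] [InnerProductSpace ℂ K] [CompleteSpace K]
  [NormedAddCommGroup L] [InnerProductSpace ℂ L] [CompleteSpace L]
  (π : A →⋆ₐ[ℂ] BoundedOp H) (σ : B →⋆ₐ[ℂ] BoundedOp K) (τ : C →⋆ₐ[ℂ] BoundedOp L)
  (J : HilbertTensor (HilbertTensor H K) L →ₗᵢ[ℂ] HilbertTensor H (HilbertTensor K L))

theorem intertwine_algLeg₂₃ (hJ : ∀ x y z, J (vtmul (vtmul x y) z) = vtmul x (vtmul y z))
    (x : B ⊗[ℂ] C) (v : HilbertTensor (HilbertTensor H K) L) :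
    J ((tensorRep (tensorRep π σ) τ (algLeg₂₃ x)).toCLM v) =
      (opRight H (HilbertTensor K L) (tensorRep σ τ x)).toCLM (J v) := by
  induction x using TensorProduct.induction_on with
  | zero => simp only [map_zero, BoundedOp.toCLM_zero]
  | add x y hx hy => simp only [map_add, BoundedOp.toCLM_add, hx, hy]
  | tmul b c =>
    rw [algLeg₂₃_tmul]
    have key : J.toContinuousLinearMap.comp
          (tensorRep (tensorRep π σ) τ (((1 : A) ⊗ₜ[ℂ] b) ⊗ₜ[ℂ] c)).toCLM =
        (opRight H (HilbertTensor K L) (tensorRep σ τ (b ⊗ₜ c))).toCLM.comp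
          J.toContinuousLinearMap := by
      refine HilbertTensor.ext₃ fun x y z => ?_
      change J ((tensorRep (tensorRep π σ) τ (((1 : A) ⊗ₜ[ℂ] b) ⊗ₜ[ℂ] c)).toCLM _) =
        (opRight H (HilbertTensor K L) (tensorRep σ τ (b ⊗ₜ c))).toCLM (J _)
      rw [tensorRep_tmul, tensorRep_tmul, tensorRep_tmul, hJ, opRight_vtmul]
      simp only [BoundedOp.toCLM_mul, opRight_vtmul, opLeft_vtmul, map_one, BoundedOp.toCLM_one,
        hJ]
    exact DFunLike.congr_fun key v

theorem intertwine_leg₁ (hJ : ∀ x y z, J (vtmul (vtmul x y) z) = vtmul x (vtmul y z))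
    (a : A) (v : HilbertTensor (HilbertTensor H K) L) :
    J ((minRep₃ π σ τ (leg₁ a)).toCLM v) =
      (opLeft H (HilbertTensor K L) (π a)).toCLM (J v) := by
  rw [leg₁_apply, minRep₃_coe]
  have key : J.toContinuousLinearMap.comp
        (tensorRep (tensorRep π σ) τ ((a ⊗ₜ[ℂ] (1 : B)) ⊗ₜ[ℂ] (1 : C))).toCLM =
      (opLeft H (HilbertTensor K L) (π a)).toCLM.comp J.toContinuousLinearMap := by
    refine HilbertTensor.ext₃ fun x y z => ?_
    change J ((tensorRep (tensorRep π σ) τ ((a ⊗ₜ[ℂ] (1 : B)) ⊗ₜ[ℂ] (1 : C))).toCLM _) =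
      (opLeft H (HilbertTensor K L) (π a)).toCLM (J _)
    rw [tensorRep_tmul, tensorRep_tmul, hJ, opLeft_vtmul]
    simp only [BoundedOp.toCLM_mul, opLeft_vtmul, map_one, BoundedOp.toCLM_one, hJ]
  exact DFunLike.congr_fun key v

end Intertwine

/-- `y ↦ 1 ⊗ y`, from `B ⊗ C` to `A ⊗ B ⊗ C`. -/
noncomputable def leg₂₃ : MinTensor B C →⋆ₐ[ℂ] MinTensor₃ A B C :=
  (minSeminorm B C).lift ((minSeminorm₃ A B C).toCompletion.comp algLeg₂₃) fun x => by
    refine MinTensor₃.norm_le ((minSeminorm B C).nonneg x) ?_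
    intro H K L _ _ _ _ _ _ _ _ _ π σ τ
    rw [StarAlgHom.comp_apply, minRep₃_coe]
    obtain ⟨J, hJ⟩ := HilbertTensor.exists_assoc (H := H) (K := K) (L := L)
    refine (norm_le_of_intertwine J _ _ (intertwine_algLeg₂₃ π σ τ J hJ x)).trans ?_
    exact (NonUnitalStarAlgHom.norm_apply_le (opRight H (HilbertTensor K L))
      (tensorRep σ τ x)).trans (norm_tensorRep_le σ τ x)

theorem leg₂₃_coe (x : B ⊗[ℂ] C) :
    (leg₂₃ ((minSeminorm B C).toCompletion x) : MinTensor₃ A B C) =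
      (minSeminorm₃ A B C).toCompletion (algLeg₂₃ x) :=
  CStarSeminorm.lift_toCompletion _ _ _ _

theorem commute_leg₁₂_leg₃ (x : MinTensor A B) (c : C) :
    Commute (leg₁₂ x) (leg₃ c : MinTensor₃ A B C) := by
  have hc : Continuous (leg₁₂ : MinTensor A B →⋆ₐ[ℂ] MinTensor₃ A B C) := continuous_starAlgHom _
  refine (minSeminorm A B).induction_completion
    (P := fun x => leg₁₂ x * leg₃ c = leg₃ c * (leg₁₂ x : MinTensor₃ A B C)) x
    (isClosed_eq (hc.mul continuous_const) (continuous_const.mul hc)) fun y => ?_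
  rw [leg₁₂_coe, leg₃_apply, ← map_mul, ← map_mul]
  simp

theorem commute_leg₁_leg₂₃ (a : A) (y : MinTensor B C) :
    Commute (leg₁ a) (leg₂₃ y : MinTensor₃ A B C) := by
  have hc : Continuous (leg₂₃ : MinTensor B C →⋆ₐ[ℂ] MinTensor₃ A B C) := continuous_starAlgHom _
  refine (minSeminorm B C).induction_completion
    (P := fun y => leg₁ a * leg₂₃ y = leg₂₃ y * (leg₁ a : MinTensor₃ A B C)) y
    (isClosed_eq (continuous_const.mul hc) (hc.mul continuous_const)) fun x => ?_
  rw [leg₂₃_coe, leg₁_apply, ← map_mul, ← map_mul]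
  congr 1
  induction x using TensorProduct.induction_on with
  | zero => simp
  | add x y hx hy => rw [map_add, mul_add, add_mul, hx, hy]
  | tmul b c => simp [algLeg₂₃_tmul]

section Maps

variable {D : Type u} [CStarAlgebra D]

theorem minRep₃_leg₁₂ {H K L : Type u} [NormedAddCommGroup H] [InnerProductSpace ℂ H]
    [CompleteSpace H] [NormedAddCommGroup K] [InnerProductSpace ℂ K] [CompleteSpace K]
    [NormedAddCommGroup L] [InnerProductSpace ℂ L] [CompleteSpace L]
    (π : A →⋆ₐ[ℂ] BoundedOp H) (σ : B →⋆ₐ[ℂ] BoundedOp K) (τ : C →⋆ₐ[ℂ] BoundedOp L)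
    (x : MinTensor A B) :
    minRep₃ π σ τ (leg₁₂ x) = opLeft (HilbertTensor H K) L (minRep π σ x) := by
  have h1 := continuous_starAlgHom ((minRep₃ π σ τ).comp leg₁₂)
  have h2 := continuous_starAlgHom ((opLeft (HilbertTensor H K) L).comp (minRep π σ))
  refine (minSeminorm A B).induction_completion
    (P := fun x => minRep₃ π σ τ (leg₁₂ x) = opLeft (HilbertTensor H K) L (minRep π σ x)) x
    (isClosed_eq h1 h2) fun y => ?_
  rw [leg₁₂_coe, minRep₃_coe, minRep_coe, tensorRep_tmul, map_one, map_one, mul_one]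

theorem intertwine_leg₂₃ {H K L : Type u} [NormedAddCommGroup H] [InnerProductSpace ℂ H]
    [CompleteSpace H] [NormedAddCommGroup K] [InnerProductSpace ℂ K] [CompleteSpace K]
    [NormedAddCommGroup L] [InnerProductSpace ℂ L] [CompleteSpace L]
    (π : A →⋆ₐ[ℂ] BoundedOp H) (σ : B →⋆ₐ[ℂ] BoundedOp K) (τ : C →⋆ₐ[ℂ] BoundedOp L)
    (J : HilbertTensor (HilbertTensor H K) L →ₗᵢ[ℂ] HilbertTensor H (HilbertTensor K L))
    (hJ : ∀ x y z, J (vtmul (vtmul x y) z) = vtmul x (vtmul y z))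
    (y : MinTensor B C) (v : HilbertTensor (HilbertTensor H K) L) :
    J ((minRep₃ π σ τ (leg₂₃ y)).toCLM v) =
      (opRight H (HilbertTensor K L) (minRep σ τ y)).toCLM (J v) := by
  have h1 := continuous_starAlgHom ((minRep₃ π σ τ).comp leg₂₃)
  have h2 := continuous_starAlgHom ((opRight H (HilbertTensor K L)).comp (minRep σ τ))
  refine (minSeminorm B C).induction_completion
    (P := fun y => J ((minRep₃ π σ τ (leg₂₃ y)).toCLM v) =
      (opRight H (HilbertTensor K L) (minRep σ τ y)).toCLM (J v)) y
    (isClosed_eq (J.continuous.comp ((BoundedOp.continuous_apply v).comp h1))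
      ((BoundedOp.continuous_apply (J v)).comp h2)) fun x => ?_
  rw [leg₂₃_coe, minRep₃_coe, minRep_coe]
  exact intertwine_algLeg₂₃ π σ τ J hJ x v

/-- `d ⊗ c ↦ φ d ⊗ c` on the algebraic tensor product. -/
noncomputable def algMapLeft (φ : D →⋆ₐ[ℂ] MinTensor A B) : D ⊗[ℂ] C →⋆ₐ[ℂ] MinTensor₃ A B C :=
  tensorLift (leg₁₂.comp φ) leg₃ fun d c => commute_leg₁₂_leg₃ (φ d) c

theorem algMapLeft_tmul (φ : D →⋆ₐ[ℂ] MinTensor A B) (d : D) (c : C) :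
    algMapLeft φ (d ⊗ₜ c) = leg₁₂ (φ d) * leg₃ c :=
  tensorLift_tmul ..

/-- `a ⊗ d ↦ a ⊗ φ d` on the algebraic tensor product. -/
noncomputable def algMapRight (φ : D →⋆ₐ[ℂ] MinTensor B C) : A ⊗[ℂ] D →⋆ₐ[ℂ] MinTensor₃ A B C :=
  tensorLift leg₁ (leg₂₃.comp φ) fun a d => commute_leg₁_leg₂₃ a (φ d)

theorem algMapRight_tmul (φ : D →⋆ₐ[ℂ] MinTensor B C) (a : A) (d : D) :
    algMapRight φ (a ⊗ₜ d) = leg₁ a * leg₂₃ (φ d) :=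
  tensorLift_tmul ..

/-- For `φ : D → A ⊗ B`, the `*`-homomorphism `φ ⊗ id : D ⊗ C → A ⊗ B ⊗ C`. -/
noncomputable def mapLeft (φ : D →⋆ₐ[ℂ] MinTensor A B) : MinTensor D C →⋆ₐ[ℂ] MinTensor₃ A B C :=
  (minSeminorm D C).lift (algMapLeft φ) fun z => by
    refine MinTensor₃.norm_le ((minSeminorm D C).nonneg z) ?_
    intro H K L _ _ _ _ _ _ _ _ _ π σ τ
    have key : minRep₃ π σ τ (algMapLeft φ z) = tensorRep ((minRep π σ).comp φ) τ z := by
      induction z using TensorProduct.induction_on with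
      | zero => simp only [map_zero]
      | add x y hx hy => simp only [map_add, hx, hy]
      | tmul d c =>
        rw [algMapLeft_tmul, tensorRep_tmul, map_mul, minRep₃_leg₁₂, StarAlgHom.comp_apply,
          leg₃_apply, minRep₃_coe, tensorRep_tmul, map_one, map_one, one_mul]
    rw [key]
    exact norm_tensorRep_le _ _ z

/-- For `φ : D → B ⊗ C`, the `*`-homomorphism `id ⊗ φ : A ⊗ D → A ⊗ B ⊗ C`. -/
noncomputable def mapRight (φ : D →⋆ₐ[ℂ] MinTensor B C) : MinTensor A D →⋆ₐ[ℂ] MinTensor₃ A B C :=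
  (minSeminorm A D).lift (algMapRight φ) fun z => by
    refine MinTensor₃.norm_le ((minSeminorm A D).nonneg z) ?_
    intro H K L _ _ _ _ _ _ _ _ _ π σ τ
    obtain ⟨J, hJ⟩ := HilbertTensor.exists_assoc (H := H) (K := K) (L := L)
    refine (norm_le_of_intertwine J _ (tensorRep π ((minRep σ τ).comp φ) z)
      fun v => ?_).trans (norm_tensorRep_le _ _ z)
    induction z using TensorProduct.induction_on generalizing v with
    | zero => simp only [map_zero, BoundedOp.toCLM_zero]
    | add x y hx hy => simp only [map_add, BoundedOp.toCLM_add, hx, hy]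
    | tmul a d =>
      rw [algMapRight_tmul, tensorRep_tmul, map_mul, BoundedOp.toCLM_mul, BoundedOp.toCLM_mul,
        intertwine_leg₁ π σ τ J hJ, intertwine_leg₂₃ π σ τ J hJ, StarAlgHom.comp_apply]

theorem mapLeft_mtmul (φ : D →⋆ₐ[ℂ] MinTensor A B) (d : D) (c : C) :
    mapLeft φ (mtmul d c) = leg₁₂ (φ d) * leg₃ c :=
  (CStarSeminorm.lift_toCompletion _ _ _ _).trans (algMapLeft_tmul φ d c)

theorem mapRight_mtmul (φ : D →⋆ₐ[ℂ] MinTensor B C) (a : A) (d : D) :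
    mapRight φ (mtmul a d) = leg₁ a * leg₂₃ (φ d) :=
  (CStarSeminorm.lift_toCompletion _ _ _ _).trans (algMapRight_tmul φ a d)

end Maps

end Ternary

end MinTensor

/-! ### Compact quantum groups -/

/-- `(A, Δ)` is a compact quantum group: `A` is a nonzero unital C⋆-algebra, the unital
`*`-homomorphism `Δ : A → A ⊗ A` satisfies `(Δ ⊗ id) Δ = (id ⊗ Δ) Δ`, and the linear spans of
`(1 ⊗ A) Δ(A)` and of `(A ⊗ 1) Δ(A)` are dense in `A ⊗ A`. -/
structure IsCompactQuantumGroup {A : Type u} [CStarAlgebra A] (Δ : A →⋆ₐ[ℂ] MinTensor A A) :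
    Prop where
  nontrivial : Nontrivial A
  coassoc : ∀ a, mapLeft (C := A) Δ (Δ a) = mapRight (A := A) Δ (Δ a)
  dense_right : Dense
    (Submodule.span ℂ {z : MinTensor A A | ∃ a b, z = mtmul 1 a * Δ b} : Set (MinTensor A A))
  dense_left : Dense
    (Submodule.span ℂ {z : MinTensor A A | ∃ a b, z = mtmul a 1 * Δ b} : Set (MinTensor A A))

/-- The relations of a magic unitary `u = (u i j)` indexed by `W`: the entries are projections
and `u* u = 1 = u u*`. -/
inductive MagicRelation (W : Type u) [Fintype W] : FreeStarAlgebra (W × W) → Prop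
  | selfAdjoint (i j : W) :
      MagicRelation W (star (FreeStarAlgebra.gen (i, j)) - FreeStarAlgebra.gen (i, j))
  | idempotent (i j : W) :
      MagicRelation W
        (FreeStarAlgebra.gen (i, j) * FreeStarAlgebra.gen (i, j) - FreeStarAlgebra.gen (i, j))
  | star_mul_self_diag (i : W) :
      MagicRelation W
        (∑ k, star (FreeStarAlgebra.gen (k, i)) * FreeStarAlgebra.gen (k, i) - 1)
  | star_mul_self_off (i j : W) (h : i ≠ j) :
      MagicRelation W
        (∑ k, star (FreeStarAlgebra.gen (k, i)) * FreeStarAlgebra.gen (k, j))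
  | mul_star_self_diag (i : W) :
      MagicRelation W
        (∑ k, FreeStarAlgebra.gen (i, k) * star (FreeStarAlgebra.gen (i, k)) - 1)
  | mul_star_self_off (i j : W) (h : i ≠ j) :
      MagicRelation W
        (∑ k, FreeStarAlgebra.gen (i, k) * star (FreeStarAlgebra.gen (j, k)))

instance (W : Type u) [Fintype W] : BoundedRelations (MagicRelation W) :=
  BoundedRelations.of_projections (fun x => MagicRelation.selfAdjoint x.1 x.2)
    (fun x => MagicRelation.idempotent x.1 x.2)

/-- The C⋆-algebra `C(S_W⁺)` of the quantum symmetric group of `W`. -/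
abbrev QuantumSymmetric (W : Type u) [Fintype W] : Type u := UniversalCStar (MagicRelation W)

/-- The entries of the magic unitary that generates `C(S_W⁺)`. -/
noncomputable def QuantumSymmetric.s {W : Type u} [Fintype W] (i j : W) : QuantumSymmetric W :=
  UniversalCStar.gen (MagicRelation W) (i, j)

/-- `(A, Δ)` is a quantum permutation group acting on the nonempty finite set `W`: a compact
quantum group with a surjective unital `*`-homomorphism `π : C(S_W⁺) → A` for which the matrix
`(π (s i j))` is a representation of `(A, Δ)`, its fundamental representation. -/
def IsQuantumPermutationGroup (W : Type u) [Fintype W] {A : Type u} [CStarAlgebra A]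
    (Δ : A →⋆ₐ[ℂ] MinTensor A A) : Prop :=
  Nonempty W ∧ IsCompactQuantumGroup Δ ∧
    ∃ π : QuantumSymmetric W →⋆ₐ[ℂ] A, Function.Surjective π ∧
      ∀ i j, Δ (π (QuantumSymmetric.s i j)) =
        ∑ k, mtmul (π (QuantumSymmetric.s i k)) (π (QuantumSymmetric.s k j))

/-! ### Games -/

/-- A game whose set of questions and set of answers are both `W`, given by its rule function:
`V a b x y` is `V(a, b | x, y)`, with answers `a, b` and questions `x, y`. -/
structure Game (W : Type u) where
  /-- The rule function. -/
  V : W → W → W → W → Bool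

namespace Game

variable {W : Type u}

/-- If both players get the same question, they must give the same answer. -/
def IsSynchronous (G : Game W) : Prop := ∀ a b x, a ≠ b → G.V a b x x = false

/-- The game is synchronous, and the players must give different answers to different
questions. -/
def IsBisynchronous (G : Game W) : Prop :=
  G.IsSynchronous ∧ ∀ a x y, x ≠ y → G.V a a x y = false

/-- If `V(a, b | r, s) = 1` and `V(r, s | x, y) = 1`, then `V(a, b | x, y) = 1`. -/
def IsTransitive (G : Game W) : Prop :=
  ∀ a b r s x y, G.V a b r s = true → G.V r s x y = true → G.V a b x y = true

variable [Fintype W]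

/-- The defining relations of the algebra of a game, in the generators `u x a`, where `x` is a
question and `a` an answer. -/
inductive Relation (G : Game W) : FreeStarAlgebra (W × W) → Prop
  | selfAdjoint (x a : W) :
      Relation G (star (FreeStarAlgebra.gen (x, a)) - FreeStarAlgebra.gen (x, a))
  | idempotent (x a : W) :
      Relation G
        (FreeStarAlgebra.gen (x, a) * FreeStarAlgebra.gen (x, a) - FreeStarAlgebra.gen (x, a))
  | sum_eq_one (x : W) : Relation G (∑ a, FreeStarAlgebra.gen (x, a) - 1)
  | orthogonal (x y a b : W) (h : G.V a b x y = false) :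
      Relation G (FreeStarAlgebra.gen (x, a) * FreeStarAlgebra.gen (y, b))

instance (G : Game W) : BoundedRelations G.Relation :=
  BoundedRelations.of_projections (fun p => Relation.selfAdjoint p.1 p.2)
    (fun p => Relation.idempotent p.1 p.2)

/-- The universal C⋆-algebra of the game. -/
abbrev CStar (G : Game W) : Type u := UniversalCStar G.Relation

/-- The canonical generators of the universal C⋆-algebra of the game. -/
noncomputable def u (G : Game W) (x a : W) : G.CStar := UniversalCStar.gen G.Relation (x, a)

/-- The defining relations of the game are realized by bounded operators on some nonzero
Hilbert space. -/
def HasPerfectCStarStrategy (G : Game W) : Prop :=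
  ∃ (H : Type u) (_ : NormedAddCommGroup H) (_ : InnerProductSpace ℂ H) (_ : CompleteSpace H)
    (_ : Nontrivial H) (π : FreeStarAlgebra (W × W) →⋆ₐ[ℂ] BoundedOp H),
    ∀ r, G.Relation r → π r = 0

/-- `Δ (u x a) = ∑ r, u x r ⊗ u r a` for all `x` and `a`. -/
def IsComultiplication (G : Game W) (Δ : G.CStar →⋆ₐ[ℂ] MinTensor G.CStar G.CStar) : Prop :=
  ∀ x a, Δ (G.u x a) = ∑ r, mtmul (G.u x r) (G.u r a)

end Game

/-! The rows of `u` consist of projections with sum 1, and the rules make two entries orthogonal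
whenever they share a row (synchrony) or a column (the second half of bisynchrony). Column sums are
not among the relations, but they equal 1 because there are as many questions as answers: each
column sum is a projection, and the defects `1 - ∑ x, u x a` are positive and add up to 0
(`col_sum`). So `u` is a magic unitary, which makes the algebra of the game a quotient of `C(S_W⁺)`.

Transitivity says that the rule function is closed under composition. Hence the family `∑ r, u x r ⊗
u r a` satisfies the relations of the game again (`comul`), and the universal property `exists_lift`
turns it into `Δ`. Uniqueness and coassociativity are checked on generators.

For density, orthogonality reduces `(1 ⊗ u s a) Δ(u x a)` to the single term `u x s ⊗ u s a`.
Summing over `a` gives `u x s ⊗ 1` by the row sums; symmetrically, the column sums give `1 ⊗ u s a`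
in the other span. `UniversalCStar.mul_mem_closure_span` passes from generators to all elementary
tensors.

The rest is C⋆-algebra: maps out of a universal algebra extend contractively when the target norm is
detected by Hilbert space representations (`NormedByRepresentations`), and a `*`-homomorphism with
dense range is onto, which gives the surjectivity of `π`. -/

/-! ### Homomorphisms with dense range -/

section DenseRange

variable {A B : Type*} [CStarAlgebra A] [CStarAlgebra B]

/-- A self-adjoint element of the range of a `*`-homomorphism of C⋆-algebras has a preimage of
no larger norm. -/
theorem StarAlgHom.exists_preimage_of_isSelfAdjoint (f : A →⋆ₐ[ℂ] B) {y : B}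
    (hy : IsSelfAdjoint y) (hr : y ∈ Set.range f) : ∃ x, f x = y ∧ ‖x‖ ≤ ‖y‖ := by
  obtain ⟨x, rfl⟩ := hr
  -- The image is self-adjoint, so any preimage may be replaced by its self-adjoint part.
  have hx : f (realPart x : A) = f x := by
    rw [realPart_apply_coe, ← Complex.coe_smul, map_smul, map_add, map_star, hy.star_eq,
      ← two_smul ℂ, smul_smul]
    norm_num
  have hs : IsSelfAdjoint (realPart x : A) := (realPart x).2
  set c := ‖f x‖ with hc
  have h0 : 0 ≤ c := norm_nonneg _
  -- Truncation to `[-c, c]`. It is the identity on the spectrum of `f x`, so applying it to the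
  -- preimage by functional calculus leaves the image unchanged and forces the norm down to `c`.
  let g : ℝ → ℝ := fun t => max (-c) (min t c)
  have hg : Continuous g := by fun_prop
  have hspec : ∀ t ∈ spectrum ℝ (f x), ‖t‖ ≤ c :=
    (norm_cfc_le_iff (id : ℝ → ℝ) (f x) h0).1 (by rw [cfc_id ℝ (f x)])
  refine ⟨cfc g (realPart x : A), ?_, norm_cfc_le h0 fun t _ => ?_⟩
  · rw [StarAlgHomClass.map_cfc f g (realPart x : A) hg.continuousOn (continuous_starAlgHom f) hs
      (by rw [hx]; exact hy), hx]
    refine (cfc_congr fun t ht => ?_).trans (cfc_id ℝ (f x))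
    have := abs_le.1 (hspec t ht)
    simp [g, min_eq_left this.2, max_eq_right this.1]
  · rw [Real.norm_eq_abs, abs_le]
    exact ⟨le_max_left _ _, max_le (by linarith) (min_le_right _ _)⟩

/-- An element of the range of a `*`-homomorphism of C⋆-algebras has a preimage of at most twice
its norm. -/
theorem StarAlgHom.exists_preimage_norm_le (f : A →⋆ₐ[ℂ] B) {y : B} (hr : y ∈ Set.range f) :
    ∃ x, f x = y ∧ ‖x‖ ≤ 2 * ‖y‖ := by
  obtain ⟨x, rfl⟩ := hr
  have hre : f (realPart x : A) = (realPart (f x) : B) := by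
    simp only [realPart_apply_coe, ← Complex.coe_smul, map_smul, map_add, map_star]
  have him : f (imaginaryPart x : A) = (imaginaryPart (f x) : B) := by
    simp only [imaginaryPart_apply_coe, ← Complex.coe_smul, map_smul, map_sub, map_star]
  -- Real and imaginary parts are lifted separately, each with norm at most `‖f x‖`; this is the
  -- source of the factor 2.
  obtain ⟨r, hr, hr'⟩ := f.exists_preimage_of_isSelfAdjoint (realPart (f x)).2 ⟨_, hre⟩
  obtain ⟨s, hs, hs'⟩ := f.exists_preimage_of_isSelfAdjoint (imaginaryPart (f x)).2 ⟨_, him⟩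
  refine ⟨r + Complex.I • s, ?_, ?_⟩
  · rw [map_add, map_smul, hr, hs, realPart_add_I_smul_imaginaryPart]
  · have h1 : ‖r‖ ≤ ‖f x‖ := hr'.trans (realPart.norm_le (f x))
    have h2 : ‖s‖ ≤ ‖f x‖ := hs'.trans (imaginaryPart.norm_le (f x))
    have h3 := norm_add_le r (Complex.I • s)
    rw [norm_smul, Complex.norm_I, one_mul] at h3
    linarith

/-- A `*`-homomorphism of C⋆-algebras with dense range is surjective. -/
theorem StarAlgHom.surjective_of_denseRange (f : A →⋆ₐ[ℂ] B) (hf : DenseRange f) :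
    Function.Surjective f := by
  let F : NormedAddGroupHom A B := AddMonoidHom.mkNormedAddGroupHom (f : A →+ B) 1 fun a => by
    rw [one_mul]; exact NonUnitalStarAlgHom.norm_apply_le f a
  have h : F.SurjectiveOnWith F.range 2 := fun y hy => f.exists_preimage_norm_le hy
  intro y
  -- Since `A` is complete, successive approximation extends the norm-controlled lifting from the
  -- range to its closure, which is all of `B`. The slack 1 in the constant is arbitrary, as the
  -- resulting norm bound is dropped.
  obtain ⟨x, hx, -⟩ := controlled_closure_of_complete two_pos one_pos h y (hf y)
  exact ⟨x, hx⟩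

end DenseRange

/-! ### The universal property -/

/-- The norm of `B` is the supremum of the seminorms of its representations on Hilbert spaces. -/
def NormedByRepresentations (B : Type u) [CStarAlgebra B] : Prop :=
  ∀ ⦃y : B⦄ ⦃M : ℝ⦄, 0 ≤ M → (∀ (H : Type u) [NormedAddCommGroup H] [InnerProductSpace ℂ H]
    [CompleteSpace H] (π : B →⋆ₐ[ℂ] BoundedOp H), ‖π y‖ ≤ M) → ‖y‖ ≤ M

/-- Representations are contractive, so a bound known on the dense image of `𝒜` passes to the
completion with an error of `ε / 2` for the approximation and `ε / 2` for its image. This replaces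
an appeal to Gelfand–Naimark: the seminorms used here are suprema over representations by
construction. -/
theorem CStarSeminorm.normedByRepresentations_completion {𝒜 : Type u} [Ring 𝒜] [StarRing 𝒜]
    [Algebra ℂ 𝒜] [StarModule ℂ 𝒜] (p : CStarSeminorm 𝒜)
    (h : ∀ ⦃x : 𝒜⦄ ⦃M : ℝ⦄, 0 ≤ M → (∀ (H : Type u) [NormedAddCommGroup H]
      [InnerProductSpace ℂ H] [CompleteSpace H] (π : p.Completion →⋆ₐ[ℂ] BoundedOp H),
      ‖π (p.toCompletion x)‖ ≤ M) → p x ≤ M) :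
    NormedByRepresentations p.Completion := by
  intro y M hM hy
  refine le_of_forall_pos_le_add fun ε hε => ?_
  obtain ⟨x, hx⟩ := p.denseRange_toCompletion.exists_dist_lt y (half_pos hε)
  rw [dist_eq_norm] at hx
  have h1 : p x ≤ M + ε / 2 := h (by positivity) fun H _ _ _ π => by
    have h2 : ‖π (y - p.toCompletion x)‖ ≤ ‖y - p.toCompletion x‖ :=
      NonUnitalStarAlgHom.norm_apply_le _ _
    have h3 := norm_sub_le (π y) (π (y - p.toCompletion x))
    rw [← map_sub, sub_sub_cancel] at h3
    have := hy H π
    linarith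
  have h4 := norm_add_le (y - p.toCompletion x) (p.toCompletion x)
  rw [sub_add_cancel, p.norm_toCompletion] at h4
  linarith

/-- The minimal norm is a supremum over the product representations, and each of these extends to
the completion as `minRep π σ`. -/
theorem MinTensor.normedByRepresentations (A B : Type u) [CStarAlgebra A] [CStarAlgebra B] :
    NormedByRepresentations (MinTensor A B) :=
  CStarSeminorm.normedByRepresentations_completion _ fun x M hM h => by
    refine CStarSeminorm.sup_le _ hM ?_
    rintro _ ⟨H, K, _, _, _, _, _, _, π, σ, rfl⟩
    have := h _ (minRep π σ)
    rwa [minRep_coe] at this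

/-! ### Homomorphisms out of the free `*`-algebra. -/

namespace FreeStarAlgebra

variable {X : Type*} {B : Type*} [CStarAlgebra B]

/-- The `*`-homomorphism from the free `*`-algebra that sends every generator `x` to `b x`. -/
noncomputable def lift (b : X → B) : FreeStarAlgebra X →⋆ₐ[ℂ] B :=
  let F : FreeStarAlgebra X →ₐ[ℂ] B :=
    MonoidAlgebra.lift ℂ B (FreeMonoid (X ⊕ X))
      -- The starred letters are independent letters of the free monoid; sending them to `star (b
      -- x)` is what makes the algebra homomorphism preserve the involution.
      (FreeMonoid.lift (Sum.elim b fun x => star (b x)))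
  have hF : ∀ s, F (letter s) = Sum.elim b (fun x => star (b x)) s := fun s => by
    refine (MonoidAlgebra.lift_single _ _ _).trans ?_
    rw [one_smul, FreeMonoid.lift_eval_of]
  { F with
    map_star' := fun a => by
      change F (star a) = star (F a)
      induction a using FreeStarAlgebra.induction with
      | hs c =>
        rw [← algebraMap_star_comm, AlgHom.commutes, AlgHom.commutes, algebraMap_star_comm]
      | hl s =>
        have : star (letter s : FreeStarAlgebra X) = letter s.swap := by
          change (starHom (letter s)).unop = _
          rw [starHom_letter]
          rfl
        rw [this, hF, hF]
        cases s <;> simp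
      | ha a b iha ihb => rw [star_add, map_add, map_add, star_add, iha, ihb]
      | hm a b iha ihb => rw [star_mul, map_mul, map_mul, star_mul, iha, ihb] }

theorem lift_gen (b : X → B) (x : X) : lift b (gen x) = b x := by
  refine (MonoidAlgebra.lift_single _ _ _).trans ?_
  rw [one_smul, FreeMonoid.lift_eval_of]
  rfl

theorem starAlgHom_ext {f g : FreeStarAlgebra X →⋆ₐ[ℂ] B} (h : ∀ x, f (gen x) = g (gen x)) :
    f = g := by
  refine StarAlgHom.ext fun a => ?_
  induction a using FreeStarAlgebra.induction with
  | hs c => rw [AlgHomClass.commutes, AlgHomClass.commutes]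
  | hl s =>
    rcases s with x | x
    · exact h x
    · rw [← star_gen, map_star, map_star, h]
  | ha a b iha ihb => rw [map_add, map_add, iha, ihb]
  | hm a b iha ihb => rw [map_mul, map_mul, iha, ihb]

end FreeStarAlgebra

/-! ### Homomorphisms out of and onto a universal C⋆-algebra. -/

namespace UniversalCStar

variable {X : Type u} (R : FreeStarAlgebra X → Prop) [BoundedRelations R]

/-- Every representation in the supremum kills `r`, so its universal seminorm is 0. -/
theorem mk_eq_zero {r : FreeStarAlgebra X} (hr : R r) : mk R r = 0 := by
  rw [← norm_le_zero_iff]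
  refine (CStarSeminorm.norm_toCompletion _ r).trans_le (CStarSeminorm.sup_le _ le_rfl ?_)
  rintro _ ⟨H, _, _, _, π, hπ, rfl⟩
  change ‖π r‖ ≤ 0
  rw [hπ r hr, norm_zero]

theorem denseRange_mk : DenseRange (mk R) := CStarSeminorm.denseRange_toCompletion _

theorem norm_le_universalSeminorm {H : Type u} [NormedAddCommGroup H] [InnerProductSpace ℂ H]
    [CompleteSpace H] (π : FreeStarAlgebra X →⋆ₐ[ℂ] BoundedOp H) (hπ : ∀ r, R r → π r = 0)
    (a : FreeStarAlgebra X) : ‖π a‖ ≤ universalSeminorm R a :=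
  CStarSeminorm.le_sup (BoundedRelations.bound_all R) ⟨H, _, _, _, π, hπ, rfl⟩ a

/-- Each representation of the relations is dominated by the universal seminorm and therefore
factors through the completion. This lets a universal algebra serve as the target of `exists_lift`.
-/
theorem normedByRepresentations : NormedByRepresentations (UniversalCStar R) :=
  CStarSeminorm.normedByRepresentations_completion _ fun x M hM h => by
    refine CStarSeminorm.sup_le _ hM ?_
    rintro _ ⟨H, _, _, _, π, hπ, rfl⟩
    have := h H ((universalSeminorm R).lift π (norm_le_universalSeminorm R π hπ))
    rwa [CStarSeminorm.lift_toCompletion] at this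

variable {R}

/-- The universal seminorm only sees Hilbert space representations, whereas `B` is abstract.
Composing the free lift with a representation of `B` yields a representation of the relations;
taking the supremum over these, `hB` shows that the free lift is contractive, so it extends to the
completion. -/
theorem exists_lift {B : Type u} [CStarAlgebra B] (hB : NormedByRepresentations B) (b : X → B)
    (hb : ∀ r, R r → FreeStarAlgebra.lift b r = 0) :
    ∃ f : UniversalCStar R →⋆ₐ[ℂ] B, ∀ x, f (gen R x) = b x := by
  refine ⟨(universalSeminorm R).lift (FreeStarAlgebra.lift b) fun a =>
    hB ((universalSeminorm R).nonneg a) fun H _ _ _ π =>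
      norm_le_universalSeminorm R (π.comp (FreeStarAlgebra.lift b))
        (fun r hr => by rw [StarAlgHom.comp_apply, hb r hr, map_zero]) a, fun x => ?_⟩
  exact (CStarSeminorm.lift_toCompletion _ _ _ _).trans (FreeStarAlgebra.lift_gen b x)

theorem starAlgHom_ext {B : Type*} [CStarAlgebra B] {f g : UniversalCStar R →⋆ₐ[ℂ] B}
    (h : ∀ x, f (gen R x) = g (gen R x)) : f = g := by
  have hmk : f.comp (mk R) = g.comp (mk R) := FreeStarAlgebra.starAlgHom_ext h
  refine StarAlgHom.ext fun a => ?_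
  exact (denseRange_mk R).induction_on a
    (isClosed_eq (continuous_starAlgHom f) (continuous_starAlgHom g))
    fun x => DFunLike.congr_fun hmk x

/-- A subalgebra that contains the generators and their adjoints contains the image of the free
`*`-algebra. -/
theorem mk_mem_of_gen_mem {S : Subalgebra ℂ (UniversalCStar R)} (h : ∀ x, gen R x ∈ S)
    (h' : ∀ x, star (gen R x) ∈ S) (a : FreeStarAlgebra X) : mk R a ∈ S := by
  induction a using FreeStarAlgebra.induction with
  | hs c => rw [AlgHomClass.commutes]; exact S.algebraMap_mem c
  | hl s =>
    rcases s with x | x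
    · exact h x
    · rw [← FreeStarAlgebra.star_gen, map_star]
      exact h' x
  | ha a b iha ihb => rw [map_add]; exact S.add_mem iha ihb
  | hm a b iha ihb => rw [map_mul]; exact S.mul_mem iha ihb

/-- A `*`-homomorphism into a universal C⋆-algebra is surjective if its range contains the
generators. -/
theorem surjective_of_gen_mem_range {A : Type*} [CStarAlgebra A] (f : A →⋆ₐ[ℂ] UniversalCStar R)
    (h : ∀ x, gen R x ∈ Set.range f) : Function.Surjective f := by
  -- It suffices that the range, a `*`-subalgebra, contains all polynomials in the generators; these
  -- are dense.
  refine f.surjective_of_denseRange ((denseRange_mk R).mono ?_)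
  rintro _ ⟨a, rfl⟩
  refine mk_mem_of_gen_mem (S := f.toAlgHom.range) h (fun x => ?_) a
  obtain ⟨y, hy⟩ := h x
  exact ⟨star y, by rw [← hy]; exact map_star f y⟩

end UniversalCStar

/-! ### Sums in completions -/

namespace CStarSeminorm

variable {𝒜 : Type*} [Ring 𝒜] [StarRing 𝒜] [Algebra ℂ 𝒜] [StarModule ℂ 𝒜] {p : CStarSeminorm 𝒜}
  {ι κ : Type*}

theorem completion_mul_sum (s : Finset ι) (f : ι → p.Completion) (x : p.Completion) :
    x * ∑ i ∈ s, f i = ∑ i ∈ s, x * f i :=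
  Finset.mul_sum s f x

theorem completion_sum_mul (s : Finset ι) (f : ι → p.Completion) (x : p.Completion) :
    (∑ i ∈ s, f i) * x = ∑ i ∈ s, f i * x :=
  Finset.sum_mul s f x

theorem completion_sum_mul_sum (s : Finset ι) (t : Finset κ) (f : ι → p.Completion)
    (g : κ → p.Completion) : (∑ i ∈ s, f i) * ∑ j ∈ t, g j = ∑ i ∈ s, ∑ j ∈ t, f i * g j :=
  Finset.sum_mul_sum s t f g

end CStarSeminorm

/-! ### Elementary tensors -/

namespace MinTensor

variable {A B : Type u} [CStarAlgebra A] [CStarAlgebra B]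

theorem mtmul_mul_mtmul (a a' : A) (b b' : B) :
    mtmul a b * mtmul a' b' = mtmul (a * a') (b * b') := by
  rw [mtmul, mtmul, ← map_mul, Algebra.TensorProduct.tmul_mul_tmul, mtmul]

theorem star_mtmul (a : A) (b : B) : star (mtmul a b) = mtmul (star a) (star b) := by
  rw [mtmul, ← map_star, TensorProduct.star_tmul, mtmul]

theorem mtmul_one_one : (mtmul 1 1 : MinTensor A B) = 1 := by
  rw [mtmul, ← Algebra.TensorProduct.one_def, map_one]

theorem zero_mtmul (b : B) : (mtmul 0 b : MinTensor A B) = 0 := by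
  rw [mtmul, TensorProduct.zero_tmul, map_zero]

theorem mtmul_zero (a : A) : (mtmul a 0 : MinTensor A B) = 0 := by
  rw [mtmul, TensorProduct.tmul_zero, map_zero]

theorem mtmul_sum {ι : Type*} (s : Finset ι) (a : A) (f : ι → B) :
    mtmul a (∑ i ∈ s, f i) = ∑ i ∈ s, mtmul a (f i) := by
  simp only [mtmul, TensorProduct.tmul_sum, map_sum]

theorem sum_mtmul {ι : Type*} (s : Finset ι) (f : ι → A) (b : B) :
    mtmul (∑ i ∈ s, f i) b = ∑ i ∈ s, mtmul (f i) b := by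
  simp only [mtmul, TensorProduct.sum_tmul, map_sum]

/-- `a ↦ a ⊗ 1`. -/
noncomputable def left (A B : Type u) [CStarAlgebra A] [CStarAlgebra B] :
    A →⋆ₐ[ℂ] MinTensor A B :=
  (minSeminorm A B).toCompletion.comp (inclLeft A B)

theorem left_apply (a : A) : left A B a = mtmul a 1 := rfl

/-- `b ↦ 1 ⊗ b`. -/
noncomputable def right (A B : Type u) [CStarAlgebra A] [CStarAlgebra B] :
    B →⋆ₐ[ℂ] MinTensor A B :=
  (minSeminorm A B).toCompletion.comp (inclRight A B)

theorem right_apply (b : B) : right A B b = mtmul 1 b := rfl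

/-- A subspace is dense if its closure contains all elementary tensors. -/
theorem dense_of_mtmul_mem {S : Submodule ℂ (MinTensor A B)}
    (h : ∀ a b, mtmul a b ∈ S.topologicalClosure) : Dense (S : Set (MinTensor A B)) := by
  have key : ∀ x : A ⊗[ℂ] B, (minSeminorm A B).toCompletion x ∈ S.topologicalClosure := fun x => by
    induction x using TensorProduct.induction_on with
    | zero => rw [map_zero]; exact zero_mem _
    | tmul a b => exact h a b
    | add x y hx hy => rw [map_add]; exact add_mem hx hy
  intro z
  exact (minSeminorm A B).induction_completion (P := fun z => z ∈ S.topologicalClosure) z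
    S.isClosed_topologicalClosure key

end MinTensor

/-! ### Density -/

section Density

variable {A C : Type*} [CStarAlgebra A] [CStarAlgebra C]

/-- The elements `a` for which left multiplication by `f a` preserves a subspace. -/
def Submodule.leftStabilizer (f : A →⋆ₐ[ℂ] C) (S : Submodule ℂ C) : Subalgebra ℂ A where
  carrier := {a | ∀ z ∈ S, f a * z ∈ S}
  mul_mem' ha hb z hz := by rw [map_mul, mul_assoc]; exact ha _ (hb _ hz)
  add_mem' ha hb z hz := by rw [map_add, add_mul]; exact S.add_mem (ha _ hz) (hb _ hz)
  algebraMap_mem' c z hz := by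
    rw [AlgHomClass.commutes, ← Algebra.smul_def]; exact S.smul_mem c hz

end Density

open MinTensor

variable {X : Type u} {R : FreeStarAlgebra X → Prop} [BoundedRelations R]

/-- If the generators are self-adjoint, `f` and `g` have commuting ranges and
`f x ∈ span (g A · Δ D)` for each generator `x`, then every `f a * g b` lies in the closure of
`span (g A · Δ D)`. -/
theorem UniversalCStar.mul_mem_closure_span {A C : Type*} [CStarAlgebra A] [CStarAlgebra C]
    {D : Type*} [CStarAlgebra D]
    (f : UniversalCStar R →⋆ₐ[ℂ] C) (g : A →⋆ₐ[ℂ] C) (Δ : D →⋆ₐ[ℂ] C)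
    (hfg : ∀ a b, Commute (f a) (g b)) (hstar : ∀ x, star (gen R x) = gen R x)
    (hgen : ∀ x, f (gen R x) ∈ Submodule.span ℂ {z | ∃ a b, z = g a * Δ b})
    (a : UniversalCStar R) (b : A) :
    f a * g b ∈ (Submodule.span ℂ {z | ∃ a b, z = g a * Δ b}).topologicalClosure := by
  set S := Submodule.span ℂ {z | ∃ a b, z = g a * Δ b} with hS
  -- `S` is a left module over `g A` and a right module over `Δ D`.
  have hg : ∀ c z, z ∈ S → g c * z ∈ S := fun c z hz => by
    induction hz using Submodule.span_induction with
    | mem z hz =>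
      obtain ⟨a, b, rfl⟩ := hz
      exact Submodule.subset_span ⟨c * a, b, by rw [map_mul, mul_assoc]⟩
    | zero => rw [mul_zero]; exact S.zero_mem
    | add x y _ _ hx hy => rw [mul_add]; exact S.add_mem hx hy
    | smul c x _ hx => rw [mul_smul_comm]; exact S.smul_mem c hx
  have hΔ : ∀ d z, z ∈ S → z * Δ d ∈ S := fun d z hz => by
    induction hz using Submodule.span_induction with
    | mem z hz =>
      obtain ⟨a, b, rfl⟩ := hz
      exact Submodule.subset_span ⟨a, b * d, by rw [map_mul, mul_assoc]⟩
    | zero => rw [zero_mul]; exact S.zero_mem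
    | add x y _ _ hx hy => rw [add_mul]; exact S.add_mem hx hy
    | smul c x _ hx => rw [smul_mul_assoc]; exact S.smul_mem c hx
  -- Since `f` and `g` commute, `f x * (g a * Δ b) = g a * f x * Δ b`, and `f x ∈ S` is only
  -- multiplied on the sides where `S` is a module. The stabilizer being a subalgebra, it then
  -- contains every polynomial in the generators.
  have hx : ∀ x, gen R x ∈ S.leftStabilizer f := fun x z hz => by
    induction hz using Submodule.span_induction with
    | mem z hz =>
      obtain ⟨a, b, rfl⟩ := hz
      rw [← mul_assoc, (hfg _ _).eq, mul_assoc]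
      exact hg _ _ (hΔ _ _ (hgen x))
    | zero => rw [mul_zero]; exact S.zero_mem
    | add x y _ _ hx hy => rw [mul_add]; exact S.add_mem hx hy
    | smul c x _ hx => rw [mul_smul_comm]; exact S.smul_mem c hx
  refine (denseRange_mk R).induction_on (p := fun a => f a * g b ∈ S.topologicalClosure) a
    (S.isClosed_topologicalClosure.preimage
      ((continuous_starAlgHom f).mul continuous_const)) fun y => ?_
  -- For a polynomial `y` no closure is needed: `mk R y` stabilizes `S`, and `g b = g b * Δ 1`
  -- belongs to `S`.
  refine S.le_topologicalClosure (mk_mem_of_gen_mem hx (fun x => ?_) y _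
    (Submodule.subset_span ⟨b, 1, by rw [map_one, mul_one]⟩))
  rw [hstar]
  exact hx x

/-! ### Representations of the relations of a game -/

namespace Game

variable {W : Type u} [Fintype W]

/-- The family `v` satisfies the defining relations of the algebra of the game. -/
structure IsRepresentation (G : Game W) {B : Type*} [CStarAlgebra B] (v : W → W → B) : Prop where
  star_eq : ∀ x a, star (v x a) = v x a
  mul_self : ∀ x a, v x a * v x a = v x a
  sum_eq_one : ∀ x, ∑ a, v x a = 1
  mul_eq_zero : ∀ x y a b, G.V a b x y = false → v x a * v y b = 0

theorem isRepresentation_u (G : Game W) : G.IsRepresentation G.u where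
  star_eq x a := by
    have := UniversalCStar.mk_eq_zero _ (Relation.selfAdjoint (G := G) x a)
    rwa [map_sub, map_star, sub_eq_zero] at this
  mul_self x a := by
    have := UniversalCStar.mk_eq_zero _ (Relation.idempotent (G := G) x a)
    rwa [map_sub, map_mul, sub_eq_zero] at this
  sum_eq_one x := by
    have := UniversalCStar.mk_eq_zero _ (Relation.sum_eq_one (G := G) x)
    rwa [map_sub, map_sum, map_one, sub_eq_zero] at this
  mul_eq_zero x y a b h := by
    have := UniversalCStar.mk_eq_zero _ (Relation.orthogonal (G := G) x y a b h)
    rwa [map_mul] at this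

/-! ### Row and column identities, and closure of representations under composition. -/

namespace IsRepresentation

variable {G : Game W} {B : Type*} [CStarAlgebra B] {v : W → W → B}

theorem lift_eq_zero (hv : G.IsRepresentation v) (r : FreeStarAlgebra (W × W))
    (hr : G.Relation r) : FreeStarAlgebra.lift (fun p => v p.1 p.2) r = 0 := by
  cases hr with
  | selfAdjoint x a => rw [map_sub, map_star, FreeStarAlgebra.lift_gen, hv.star_eq, sub_self]
  | idempotent x a => rw [map_sub, map_mul, FreeStarAlgebra.lift_gen, hv.mul_self, sub_self]
  | sum_eq_one x =>
    simp only [map_sub, map_sum, map_one, FreeStarAlgebra.lift_gen, hv.sum_eq_one, sub_self]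
  | orthogonal x y a b h =>
    rw [map_mul, FreeStarAlgebra.lift_gen, FreeStarAlgebra.lift_gen, hv.mul_eq_zero x y a b h]

theorem row_mul (hv : G.IsRepresentation v) (hG : G.IsSynchronous) {x a b : W} (h : a ≠ b) :
    v x a * v x b = 0 :=
  hv.mul_eq_zero _ _ _ _ (hG a b x h)

theorem col_mul (hv : G.IsRepresentation v) (hG : G.IsBisynchronous) {x y a : W} (h : x ≠ y) :
    v x a * v y a = 0 :=
  hv.mul_eq_zero _ _ _ _ (hG.2 a x y h)

/-- Entries of one column are orthogonal projections, so their sum is a projection and its defect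
from 1 is positive. Adding all defects and exchanging the sums compares the number of columns with
the number of rows; both are the cardinality of `W`. A vanishing sum of positive elements has
vanishing terms. -/
theorem col_sum (hv : G.IsRepresentation v) (hG : G.IsBisynchronous) (a : W) :
    ∑ x, v x a = 1 := by
  classical
  let _ : PartialOrder B := CStarAlgebra.spectralOrder B
  have _ : StarOrderedRing B := CStarAlgebra.spectralOrderedRing B
  have hmul : ∀ a, (∑ x, v x a) * ∑ x, v x a = ∑ x, v x a := fun a => by
    rw [Finset.sum_mul_sum]
    refine Finset.sum_congr rfl fun x _ => ?_
    rw [Finset.sum_eq_single x (fun y _ h => hv.col_mul hG h.symm) (by simp), hv.mul_self]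
  have hproj : ∀ a, IsStarProjection (∑ x, v x a) := fun a =>
    ⟨hmul a, by rw [IsSelfAdjoint, star_sum]; simp only [hv.star_eq]⟩
  have hsum : ∑ a, (1 - ∑ x, v x a) = 0 := by
    rw [Finset.sum_sub_distrib, Finset.sum_comm]
    simp only [hv.sum_eq_one, sub_self]
  exact (sub_eq_zero.1 ((Finset.sum_eq_zero_iff_of_nonneg
    fun a _ => (hproj a).one_sub.nonneg).1 hsum a (Finset.mem_univ a))).symm

/-- The family `∑ r, v x r ⊗ w r a`. -/
theorem comul {A B : Type u} [CStarAlgebra A] [CStarAlgebra B] {v : W → W → A} {w : W → W → B}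
    (hv : G.IsRepresentation v) (hw : G.IsRepresentation w) (hG : G.IsSynchronous)
    (htr : G.IsTransitive) :
    G.IsRepresentation fun x a => ∑ r, mtmul (v x r) (w r a) where
  star_eq x a := by simp only [star_sum, star_mtmul, hv.star_eq, hw.star_eq]
  mul_self x a := by
    classical
    rw [CStarSeminorm.completion_sum_mul_sum]
    refine Finset.sum_congr rfl fun r _ => ?_
    -- The cross terms `r ≠ s` vanish already in the first leg, by row orthogonality of `v`.
    rw [Finset.sum_eq_single r (fun s _ h => ?_) (by simp), mtmul_mul_mtmul, hv.mul_self,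
      hw.mul_self]
    rw [mtmul_mul_mtmul, hv.row_mul hG h.symm, zero_mtmul]
  sum_eq_one x := by
    rw [Finset.sum_comm]
    simp only [← mtmul_sum, hw.sum_eq_one, ← sum_mtmul, hv.sum_eq_one, mtmul_one_one]
  mul_eq_zero x y a b h := by
    rw [CStarSeminorm.completion_sum_mul_sum]
    refine Finset.sum_eq_zero fun r _ => Finset.sum_eq_zero fun s _ => ?_
    rw [mtmul_mul_mtmul]
    -- A term can survive only if `V(r,s|x,y) = 1` (first leg) and `V(a,b|r,s) = 1` (second leg);
    -- transitivity would then give `V(a,b|x,y) = 1`.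
    cases h1 : G.V r s x y with
    | false => rw [hv.mul_eq_zero _ _ _ _ h1, zero_mtmul]
    | true =>
      cases h2 : G.V a b r s with
      | false => rw [hw.mul_eq_zero _ _ _ _ h2, mtmul_zero]
      | true => rw [htr a b r s x y h2 h1] at h; cases h

/-- For projections, the diagonal entries of `v* v` and `v v*` are the column and row sums. The
off-diagonal entries vanish term by term: those of `v* v` by row orthogonality, those of `v v*` by
column orthogonality. -/
theorem magicRelation_lift_eq_zero (hv : G.IsRepresentation v) (hG : G.IsBisynchronous)
    (r : FreeStarAlgebra (W × W)) (hr : MagicRelation W r) :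
    FreeStarAlgebra.lift (fun p => v p.1 p.2) r = 0 := by
  cases hr with
  | selfAdjoint x a => rw [map_sub, map_star, FreeStarAlgebra.lift_gen, hv.star_eq, sub_self]
  | idempotent x a => rw [map_sub, map_mul, FreeStarAlgebra.lift_gen, hv.mul_self, sub_self]
  | star_mul_self_diag i =>
    simp only [map_sub, map_sum, map_mul, map_star, map_one, FreeStarAlgebra.lift_gen, hv.star_eq,
      hv.mul_self, hv.col_sum hG, sub_self]
  | star_mul_self_off i j h =>
    simp only [map_sum, map_mul, map_star, FreeStarAlgebra.lift_gen, hv.star_eq, hv.row_mul hG.1 h,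
      Finset.sum_const_zero]
  | mul_star_self_diag i =>
    simp only [map_sub, map_sum, map_mul, map_star, map_one, FreeStarAlgebra.lift_gen, hv.star_eq,
      hv.mul_self, hv.sum_eq_one, sub_self]
  | mul_star_self_off i j h =>
    simp only [map_sum, map_mul, map_star, FreeStarAlgebra.lift_gen, hv.star_eq, hv.col_mul hG h,
      Finset.sum_const_zero]

end IsRepresentation

/-! ### The comultiplication -/

theorem exists_comultiplication (G : Game W) (hG : G.IsSynchronous) (htr : G.IsTransitive) :
    ∃ Δ : G.CStar →⋆ₐ[ℂ] MinTensor G.CStar G.CStar, G.IsComultiplication Δ := by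
  obtain ⟨Δ, hΔ⟩ := UniversalCStar.exists_lift (MinTensor.normedByRepresentations G.CStar G.CStar)
    _ (G.isRepresentation_u.comul G.isRepresentation_u hG htr).lift_eq_zero
  exact ⟨Δ, fun x a => hΔ (x, a)⟩

/-- A unital representation on a nonzero space bounds the universal seminorm of 1 away from 0. -/
theorem nontrivial_cstar {G : Game W} (hG : G.HasPerfectCStarStrategy) : Nontrivial G.CStar := by
  obtain ⟨H, _, _, _, _, π, hπ⟩ := hG
  refine ⟨1, 0, fun h => ?_⟩
  have h1 := UniversalCStar.norm_le_universalSeminorm G.Relation π hπ 1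
  have h2 : ‖(1 : G.CStar)‖ = universalSeminorm G.Relation 1 := by
    rw [← map_one (UniversalCStar.mk G.Relation)]
    exact CStarSeminorm.norm_toCompletion _ _
  rw [← h2, h, norm_zero, norm_le_zero_iff, map_one] at h1
  obtain ⟨v, hv⟩ := exists_ne (0 : H)
  refine hv ?_
  rw [← BoundedOp.toCLM_one v, h1, BoundedOp.toCLM_zero]

/-! ### Coassociativity and the two density conditions. -/

namespace IsComultiplication

variable {G : Game W} {Δ : G.CStar →⋆ₐ[ℂ] MinTensor G.CStar G.CStar}

theorem coassoc (hΔ : G.IsComultiplication Δ) (a : G.CStar) :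
    mapLeft (C := G.CStar) Δ (Δ a) = mapRight (A := G.CStar) Δ (Δ a) := by
  have key : (mapLeft (C := G.CStar) Δ).comp Δ = (mapRight (A := G.CStar) Δ).comp Δ := by
    refine UniversalCStar.starAlgHom_ext fun ⟨x, a⟩ => ?_
    change mapLeft Δ (Δ (G.u x a)) = mapRight Δ (Δ (G.u x a))
    rw [hΔ, map_sum, map_sum]
    simp only [mapLeft_mtmul, mapRight_mtmul, hΔ _ _, map_sum,
      CStarSeminorm.completion_sum_mul, CStarSeminorm.completion_mul_sum]
    -- Both sides are the double sum of `u x r ⊗ u r s ⊗ u s a`, with the two summations in opposite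
    -- order.
    rw [Finset.sum_comm]
    refine Finset.sum_congr rfl fun s _ => Finset.sum_congr rfl fun r _ => ?_
    rw [mtmul, mtmul, leg₁₂_coe, leg₂₃_coe, leg₃_apply, leg₁_apply, algLeg₂₃_tmul, ← map_mul,
      ← map_mul]
    simp
  exact DFunLike.congr_fun key a

/-- Column orthogonality in the second leg selects the term `r = s` of the comultiplication. -/
theorem right_mul_gen (hΔ : G.IsComultiplication Δ) (hG : G.IsBisynchronous) (x s a : W) :
    mtmul 1 (G.u s a) * Δ (G.u x a) = mtmul (G.u x s) (G.u s a) := by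
  classical
  rw [hΔ, CStarSeminorm.completion_mul_sum, Finset.sum_eq_single s (fun r _ h => ?_) (by simp),
    mtmul_mul_mtmul, one_mul, G.isRepresentation_u.mul_self]
  rw [mtmul_mul_mtmul, G.isRepresentation_u.col_mul hG h.symm, mtmul_zero]

/-- The mirror image: row orthogonality in the first leg selects the term `r = s`. -/
theorem left_mul_gen (hΔ : G.IsComultiplication Δ) (hG : G.IsBisynchronous) (x s a : W) :
    mtmul (G.u x s) 1 * Δ (G.u x a) = mtmul (G.u x s) (G.u s a) := by
  classical
  rw [hΔ, CStarSeminorm.completion_mul_sum, Finset.sum_eq_single s (fun r _ h => ?_) (by simp),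
    mtmul_mul_mtmul, one_mul, G.isRepresentation_u.mul_self]
  rw [mtmul_mul_mtmul, G.isRepresentation_u.row_mul hG.1 h.symm, zero_mtmul]

theorem dense_right (hΔ : G.IsComultiplication Δ) (hG : G.IsBisynchronous) :
    Dense (Submodule.span ℂ {z : MinTensor G.CStar G.CStar | ∃ a b, z = mtmul 1 a * Δ b} :
      Set (MinTensor G.CStar G.CStar)) := by
  refine dense_of_mtmul_mem fun a b => ?_
  have := UniversalCStar.mul_mem_closure_span (left G.CStar G.CStar) (right G.CStar G.CStar) Δ
    (fun a b => by simp [Commute, SemiconjBy, left_apply, right_apply, mtmul_mul_mtmul])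
    (fun x => G.isRepresentation_u.star_eq x.1 x.2) (fun ⟨x, s⟩ => ?_) a b
  · rwa [left_apply, right_apply, mtmul_mul_mtmul, mul_one, one_mul] at this
  · change mtmul (G.u x s) 1 ∈ _
    -- Expanding the second 1 as a row sum gives `u x s ⊗ 1 = ∑ a, (1 ⊗ u s a) Δ(u x a)`.
    rw [← G.isRepresentation_u.sum_eq_one s, mtmul_sum]
    exact Submodule.sum_mem _ fun a _ =>
      Submodule.subset_span ⟨G.u s a, G.u x a, (hΔ.right_mul_gen hG x s a).symm⟩

theorem dense_left (hΔ : G.IsComultiplication Δ) (hG : G.IsBisynchronous) :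
    Dense (Submodule.span ℂ {z : MinTensor G.CStar G.CStar | ∃ a b, z = mtmul a 1 * Δ b} :
      Set (MinTensor G.CStar G.CStar)) := by
  refine dense_of_mtmul_mem fun a b => ?_
  have := UniversalCStar.mul_mem_closure_span (right G.CStar G.CStar) (left G.CStar G.CStar) Δ
    (fun a b => by simp [Commute, SemiconjBy, left_apply, right_apply, mtmul_mul_mtmul])
    (fun x => G.isRepresentation_u.star_eq x.1 x.2) (fun ⟨s, a⟩ => ?_) b a
  · rwa [left_apply, right_apply, mtmul_mul_mtmul, mul_one, one_mul] at this
  · change mtmul 1 (G.u s a) ∈ _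
    -- Here the derived column sums are needed: `1 ⊗ u s a = ∑ x, (u x s ⊗ 1) Δ(u x a)`.
    rw [← G.isRepresentation_u.col_sum hG s, sum_mtmul]
    exact Submodule.sum_mem _ fun x _ =>
      Submodule.subset_span ⟨G.u x s, G.u x a, (hΔ.left_mul_gen hG x s a).symm⟩

/-! ### The quantum group structure and the quotient map from `C(S_W⁺)`. -/

theorem isCompactQuantumGroup (hΔ : G.IsComultiplication Δ) (hbs : G.IsBisynchronous)
    (hG : G.HasPerfectCStarStrategy) : IsCompactQuantumGroup Δ where
  nontrivial := nontrivial_cstar hG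
  coassoc := hΔ.coassoc
  dense_right := hΔ.dense_right hbs
  dense_left := hΔ.dense_left hbs

/-- As `u` is a magic unitary, there is a map `π` with `s i j ↦ u i j`. Its range contains the
generators, hence is everything, and the condition on `Δ` becomes the defining formula of the
comultiplication. -/
theorem isQuantumPermutationGroup [Nonempty W] (hΔ : G.IsComultiplication Δ)
    (hbs : G.IsBisynchronous) (hG : G.HasPerfectCStarStrategy) :
    IsQuantumPermutationGroup W Δ := by
  obtain ⟨π, hπ⟩ := UniversalCStar.exists_lift
    (UniversalCStar.normedByRepresentations G.Relation) (R := MagicRelation W) _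
    (G.isRepresentation_u.magicRelation_lift_eq_zero hbs)
  have hs : ∀ i j, π (QuantumSymmetric.s i j) = G.u i j := fun i j => hπ (i, j)
  refine ⟨inferInstance, hΔ.isCompactQuantumGroup hbs hG, π,
    UniversalCStar.surjective_of_gen_mem_range π fun p => ⟨_, hπ p⟩, fun i j => ?_⟩
  simp only [hs]
  exact hΔ i j

end IsComultiplication

end Game

theorem mainTheorem1 {W : Type u} [Fintype W] [Nonempty W] (G : Game W)
    (hbs : G.IsBisynchronous) (htr : G.IsTransitive) (hG : G.HasPerfectCStarStrategy) :
    (∃! Δ : G.CStar →⋆ₐ[ℂ] MinTensor G.CStar G.CStar, G.IsComultiplication Δ) ∧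
    ∀ Δ : G.CStar →⋆ₐ[ℂ] MinTensor G.CStar G.CStar, G.IsComultiplication Δ →
      IsCompactQuantumGroup Δ ∧ IsQuantumPermutationGroup W Δ := by
  obtain ⟨Δ, hΔ⟩ := G.exists_comultiplication hbs.1 htr
  -- Uniqueness: the formula fixes the values on the generators, and `*`-homomorphisms of
  -- C⋆-algebras are continuous.
  refine ⟨⟨Δ, hΔ, fun Δ' hΔ' => UniversalCStar.starAlgHom_ext fun ⟨x, a⟩ =>
    (hΔ' x a).trans (hΔ x a).symm⟩, fun Δ hΔ =>
    ⟨hΔ.isCompactQuantumGroup hbs hG, hΔ.isQuantumPermutationGroup hbs hG⟩⟩
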